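/- Let $\mathcal H$ be a complex Hilbert space with an orthogonal decomposition $\mathcal H=\mathcal H_+\oplus\mathcal H_-$ into two infinite dimensional closed subspaces, let $E_+$ be the orthogonal projection onto $\mathcal H_+$, and let $1\le p<\infty$. Let $\mathcal B_p$ denote the Schatten class of operators $T$ with $\mathrm{Tr}(|T|^p)<\infty$, with norm $\|T\|_p=\mathrm{Tr}(|T|^p)^{1/p}$. Let $$\mathcal A^p=\{A\in\mathcal B(\mathcal H): AE_+-E_+A\in\mathcal B_p(\mathcal H)\},$$ with the norm $\|A\|_{\infty,p}=\|A_{11}\|+\|A_{22}\|+\|A_{12}\|_p+\|A_{21}\|_p$, where $(A_{ij})$ is the $2\times 2$ matrix of $A$ with respect to $\mathcal H=\mathcal H_+\oplus\mathcal H_-$. Let $\mathcal G_{\mathcal A^p}$ be the group of invertible elements of the algebra $\mathcal A^p$, and let $\mathcal U_{\mathcal A^p}$ be the set of elements of $\mathcal G_{\mathcal A^p}$ that are unitary operators in $\mathcal H$. The index of an element $A\in\mathcal G_{\mathcal A^p}$ is the Fredholm index of its entry $A_{11}\in\mathcal B(\mathcal H_+)$. Let $G\in\mathcal G_{\mathcal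 A^p}$. Then $G$ has a unique polar decomposition $G=U|G|$ (with $|G|=(G^*G)^{1/2}$ and $U$ a partial isometry with $\ker U=\ker G$), and $|G|\in\mathcal G_{\mathcal A^p}$ and $U\in\mathcal U_{\mathcal A^p}$. Moreover, $G_{11}$ and $U_{11}$ are Fredholm operators, $G$ and $U$ have the same index, and $G$ and $U$ lie in the same connected component of $\mathcal G_{\mathcal A^p}$ for the topology of the norm $\|\cdot\|_{\infty,p}$. -/

import Mathlib

open scoped ENNReal

noncomputable section

section Schatten

variable {H₁ H₂ : Type*}
  [NormedAddCommGroup H₁] [InnerProductSpace ℂ H₁] [CompleteSpace H₁]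
  [NormedAddCommGroup H₂] [InnerProductSpace ℂ H₂] [CompleteSpace H₂]

/-- The sum `∑ ⟨eᵢ, A eᵢ⟩` over a Hilbert basis `(eᵢ)`, for a positive operator `A`. -/
def diagonalSum {ι : Type*} (b : HilbertBasis ι ℂ H₁) (A : H₁ →L[ℂ] H₁) : ℝ≥0∞ :=
  ∑' i, ENNReal.ofReal (RCLike.re (inner ℂ (b i) (A (b i))))

/-- The `[0, ∞]`-valued trace of a positive operator, computed in some Hilbert basis; it does not
depend on that basis, see `diagonalSum_eq_positiveTrace`. -/
def positiveTrace (A : H₁ →L[ℂ] H₁) : ℝ≥0∞ :=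
  diagonalSum (exists_hilbertBasis ℂ H₁).choose_spec.choose A

lemma diagonalSum_eq_tsum_enorm_sq {ι : Type*} (b : HilbertBasis ι ℂ H₁) (B : H₁ →L[ℂ] H₁) :
    diagonalSum b (star B * B) = ∑' i, ‖B (b i)‖ₑ ^ 2 := by
  unfold diagonalSum
  refine tsum_congr fun i => ?_
  rw [mul_apply_eq_comp, ContinuousLinearMap.star_eq_adjoint,
    ContinuousLinearMap.adjoint_inner_right, inner_self_eq_norm_sq,
    ENNReal.ofReal_pow (norm_nonneg _), ofReal_norm]

lemma tsum_enorm_inner_sq {ι : Type*} (b : HilbertBasis ι ℂ H₁) (x : H₁) :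
    ∑' i, ‖inner ℂ (b i) x‖ₑ ^ 2 = ‖x‖ₑ ^ 2 := by
  have h : HasSum (fun i => ‖inner ℂ (b i) x‖ ^ 2) (‖x‖ ^ 2) := by
    have h1 := (b.hasSum_inner_mul_inner x x).mapL (RCLike.reCLM (K := ℂ))
    have h2 : ∀ i, RCLike.reCLM (K := ℂ) (inner ℂ x (b i) * inner ℂ (b i) x)
        = ‖inner ℂ (b i) x‖ ^ 2 := by
      intro i
      rw [← inner_conj_symm x (b i), RCLike.conj_mul, RCLike.reCLM_apply]
      norm_cast
    simp only [h2] at h1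
    rwa [RCLike.reCLM_apply, inner_self_eq_norm_sq] at h1
  have h3 := h.summable
  have := ENNReal.ofReal_tsum_of_nonneg (fun i => by positivity) h3
  rw [h.tsum_eq] at this
  simp only [ENNReal.ofReal_pow (norm_nonneg _), ofReal_norm] at this
  exact this.symm

lemma tsum_enorm_sq_eq_star {ι κ : Type*} (b : HilbertBasis ι ℂ H₁) (c : HilbertBasis κ ℂ H₁)
    (B : H₁ →L[ℂ] H₁) :
    ∑' i, ‖B (b i)‖ₑ ^ 2 = ∑' j, ‖star B (c j)‖ₑ ^ 2 := by
  calc ∑' i, ‖B (b i)‖ₑ ^ 2 = ∑' i, ∑' j, ‖inner ℂ (c j) (B (b i))‖ₑ ^ 2 := by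
        simp only [tsum_enorm_inner_sq]
    _ = ∑' j, ∑' i, ‖inner ℂ (c j) (B (b i))‖ₑ ^ 2 := ENNReal.tsum_comm
    _ = ∑' j, ∑' i, ‖inner ℂ (b i) (star B (c j))‖ₑ ^ 2 := by
        refine tsum_congr fun j => tsum_congr fun i => ?_
        rw [ContinuousLinearMap.star_eq_adjoint, ContinuousLinearMap.adjoint_inner_right,
          ← inner_conj_symm, ← ofReal_norm, ← ofReal_norm, RCLike.norm_conj]
    _ = ∑' j, ‖star B (c j)‖ₑ ^ 2 := by simp only [tsum_enorm_inner_sq]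

lemma diagonalSum_eq_positiveTrace {ι : Type*} (b : HilbertBasis ι ℂ H₁) {A : H₁ →L[ℂ] H₁}
    (hA : 0 ≤ A) : diagonalSum b A = positiveTrace A := by
  have h1 : star (CFC.sqrt A) = CFC.sqrt A := (CFC.sqrt_nonneg A).isSelfAdjoint.star_eq
  have h2 : A = star (CFC.sqrt A) * CFC.sqrt A := by
    rw [h1, CFC.sqrt_mul_sqrt_self A hA]
  unfold positiveTrace
  rw [h2, diagonalSum_eq_tsum_enorm_sq, diagonalSum_eq_tsum_enorm_sq, tsum_enorm_sq_eq_star b b,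
    ← tsum_enorm_sq_eq_star _ b]

/-- The absolute value `|T| = (T* T)^{1/2}` of a bounded operator between two Hilbert spaces. -/
def operatorAbs (T : H₁ →L[ℂ] H₂) : H₁ →L[ℂ] H₁ :=
  CFC.sqrt (ContinuousLinearMap.adjoint T ∘L T)

/-- The Schatten norm `‖T‖_p = Tr(|T|^p)^{1/p}`, with value `∞` outside the Schatten class. -/
def schattenNorm (p : ℝ) (T : H₁ →L[ℂ] H₂) : ℝ≥0∞ :=
  positiveTrace (operatorAbs T ^ p) ^ (1 / p)

/-- The Schatten class `B_p(H₁, H₂)`: the operators with `Tr(|T|^p) < ∞`. -/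
def schattenClass (p : ℝ) : Set (H₁ →L[ℂ] H₂) :=
  {T | positiveTrace (operatorAbs T ^ p) < ∞}

end Schatten

section Restricted

variable {H : Type*} [NormedAddCommGroup H] [InnerProductSpace ℂ H] [CompleteSpace H]

/-- The matrix entry `K → L` of `A`: restriction to `K` followed by projection onto `L`. -/
def matrixEntry (K L : Submodule ℂ H) [L.HasOrthogonalProjection] (A : H →L[ℂ] H) : K →L[ℂ] L :=
  L.orthogonalProjectionOnto ∘L A ∘L K.subtypeL

/-- The algebra `A^p = {A : [A, E₊] ∈ B_p(H)}`, where `E₊` is the orthogonal projection onto the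
closed subspace `K = H₊`. -/
def restrictedAlgebra (K : Submodule ℂ H) [K.HasOrthogonalProjection] (p : ℝ) :
    Set (H →L[ℂ] H) :=
  {A | A * K.starProjection - K.starProjection * A ∈ schattenClass p}

/-- The norm `‖A‖_{∞,p} = ‖A₁₁‖ + ‖A₂₂‖ + ‖A₁₂‖_p + ‖A₂₁‖_p` in terms of the entries of `A` with
respect to `H = K ⊕ Kᗮ`; it is finite on `A^p`. -/
def restrictedNorm (K : Submodule ℂ H) [CompleteSpace K] (p : ℝ) (A : H →L[ℂ] H) : ℝ≥0∞ :=
  ‖matrixEntry K K A‖ₑ + ‖matrixEntry Kᗮ Kᗮ A‖ₑ +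
    schattenNorm p (matrixEntry Kᗮ K A) + schattenNorm p (matrixEntry K Kᗮ A)

/-- The topology of `A^p` given by the norm `‖·‖_{∞,p}`. -/
@[reducible]
def restrictedTopology (K : Submodule ℂ H) [CompleteSpace K] (p : ℝ) :
    TopologicalSpace (restrictedAlgebra K p) where
  IsOpen s := ∀ A ∈ s, ∃ ε : ℝ, 0 < ε ∧ ∀ B : restrictedAlgebra K p,
    restrictedNorm K p (B.1 - A.1) < ENNReal.ofReal ε → B ∈ s
  isOpen_univ _ _ := ⟨1, one_pos, fun _ _ => trivial⟩
  isOpen_inter s t hs ht A hA := by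
    obtain ⟨ε, hε, h⟩ := hs A hA.1
    obtain ⟨δ, hδ, h'⟩ := ht A hA.2
    refine ⟨min ε δ, lt_min hε hδ, fun B hB => ⟨h B (hB.trans_le ?_), h' B (hB.trans_le ?_)⟩⟩
    · exact ENNReal.ofReal_le_ofReal (min_le_left _ _)
    · exact ENNReal.ofReal_le_ofReal (min_le_right _ _)
  isOpen_sUnion S hS A hA := by
    obtain ⟨s, hs, hAs⟩ := hA
    obtain ⟨ε, hε, h⟩ := hS s hs A hAs
    exact ⟨ε, hε, fun B hB => ⟨s, hs, h B hB⟩⟩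

/-- The group `G_{A^p}` of the invertible elements of the algebra `A^p`. -/
def restrictedInvertibles (K : Submodule ℂ H) [K.HasOrthogonalProjection] (p : ℝ) :
    Set (restrictedAlgebra K p) :=
  {A | ∃ B : restrictedAlgebra K p, A.1 * B.1 = 1 ∧ B.1 * A.1 = 1}

/-- The group `U_{A^p}` of the elements of `G_{A^p}` that are unitary operators in `H`. -/
def restrictedUnitaries (K : Submodule ℂ H) [K.HasOrthogonalProjection] (p : ℝ) :
    Set (restrictedAlgebra K p) :=
  {A | A ∈ restrictedInvertibles K p ∧ A.1 ∈ unitary (H →L[ℂ] H)}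

/-- The connected component of `A` in `G_{A^p}`, for the topology of the norm `‖·‖_{∞,p}`. -/
def restrictedComponent (K : Submodule ℂ H) [CompleteSpace K] (p : ℝ)
    (A : restrictedAlgebra K p) : Set (restrictedAlgebra K p) :=
  @connectedComponentIn _ (restrictedTopology K p) (restrictedInvertibles K p) A

/-- `G = U |G|` is the polar decomposition of `G`: the factor `U` is the partial isometry with the
same kernel as `G`. -/
structure IsPolarDecomposition (G U : H →L[ℂ] H) : Prop where
  eq_mul_abs : G = U * operatorAbs G
  partial_isometry : U * star U * U = U
  ker_eq : U.ker = G.ker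

end Restricted

end

/-! Since `G` is invertible, `|G|` is strictly positive, so `G = U|G|` forces `U = G|G|⁻¹`, which is
unitary. The analytic point is that `|G|` belongs to `A^p`. Write `E` for the projection onto `K`
and `X = [|G|, E]`. Then `|G|X + X|G| = [|G|², E] = [G*G, E]`, and the right side is in the Schatten
class because `A^p` is a *-algebra. As `|G| = c(1 - b)` with `‖b‖ < 1`, this Sylvester equation
exhibits `X` as the fixed point of a contraction that preserves a Schatten ball
(`HasSchattenBound.exists_of_mul_add_mul`). Inverses stay in `A^p` by `[B, E] = -B[A, E]B`.

The trace definition of the Schatten class is awkward for sums and products. It is replaced by the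
equivalent `HasSchattenBound`, a uniform bound on `ℓ^p`-norms of diagonals over pairs of finite
orthonormal families: the triangle inequality is then Minkowski's, and unitary invariance is
immediate. The equivalence is `hasSchattenBound_of_mem_schattenClass` and
`HasSchattenBound.mem_schattenClass`.

Off-diagonal entries of elements of `A^p` are norm limits of finite rank operators, so the diagonal
entries of mutually inverse elements are inverse up to such limits, hence Fredholm by Atkinson's
criterion. Up to such a limit `G₁₁` is `U₁₁|G|₁₁`, where `|G|₁₁` is invertible, so the indices
agree. The segment from `|G|` to `1` consists of strictly positive operators; multiplied by `U` it
joins `G` to `U`. -/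

/-! ### Schatten bounds through finite orthonormal families -/

section SchattenBound

variable {H₁ H₂ : Type*}
  [NormedAddCommGroup H₁] [InnerProductSpace ℂ H₁]
  [NormedAddCommGroup H₂] [InnerProductSpace ℂ H₂]

/-- The `ℓ^p`-norms of the diagonals of `T` with respect to pairs of finite orthonormal families
are bounded by `C`. -/
def HasSchattenBound (p C : ℝ) (T : H₁ →L[ℂ] H₂) : Prop :=
  ∀ (n : ℕ) (e : Fin n → H₁) (f : Fin n → H₂), Orthonormal ℂ e → Orthonormal ℂ f →
    (∑ i, ‖inner ℂ (f i) (T (e i))‖ ^ p) ^ (1 / p) ≤ C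

namespace HasSchattenBound

variable {p C D : ℝ} {S T : H₁ →L[ℂ] H₂}

lemma nonneg (hT : HasSchattenBound p C T) : 0 ≤ C :=
  le_trans (by positivity) (hT 0 Fin.elim0 Fin.elim0 (by simp [Orthonormal])
    (by simp [Orthonormal]))

lemma mono (hT : HasSchattenBound p C T) (h : C ≤ D) : HasSchattenBound p D T :=
  fun n e f he hf => (hT n e f he hf).trans h

lemma of_sum_le (hp : 0 < p) {M : ℝ} (hT : ∀ (n : ℕ) (e : Fin n → H₁) (f : Fin n → H₂),
    Orthonormal ℂ e → Orthonormal ℂ f → ∑ i, ‖inner ℂ (f i) (T (e i))‖ ^ p ≤ M) :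
    HasSchattenBound p (M ^ (1 / p)) T :=
  fun n e f he hf => Real.rpow_le_rpow (by positivity) (hT n e f he hf) (by positivity)

lemma sum_le (hp : 0 < p) (hT : HasSchattenBound p C T) {n : ℕ} {e : Fin n → H₁}
    {f : Fin n → H₂} (he : Orthonormal ℂ e) (hf : Orthonormal ℂ f) :
    ∑ i, ‖inner ℂ (f i) (T (e i))‖ ^ p ≤ C ^ p := by
  have h := Real.rpow_le_rpow (by positivity) (hT n e f he hf) hp.le
  rwa [← Real.rpow_mul (by positivity), one_div, inv_mul_cancel₀ hp.ne', Real.rpow_one] at h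

lemma zero (hp : 0 < p) : HasSchattenBound p 0 (0 : H₁ →L[ℂ] H₂) := by
  intro n e f _ _
  simp [Real.zero_rpow hp.ne', Real.zero_rpow (inv_ne_zero hp.ne')]

lemma add (hp : 1 ≤ p) (hS : HasSchattenBound p C S) (hT : HasSchattenBound p D T) :
    HasSchattenBound p (C + D) (S + T) := by
  intro n e f he hf
  have hp0 : 0 < p := by linarith
  have h := Real.Lp_add_le Finset.univ (fun i => ‖inner ℂ (f i) (S (e i))‖)
    (fun i => ‖inner ℂ (f i) (T (e i))‖) hp
  simp only [abs_norm] at h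
  refine le_trans (Real.rpow_le_rpow (by positivity) (Finset.sum_le_sum fun i _ => ?_)
    (by positivity)) (h.trans (add_le_add (hS n e f he hf) (hT n e f he hf)))
  rw [add_apply, inner_add_right, abs_of_nonneg (by positivity)]
  gcongr
  exact norm_add_le _ _

lemma smul (hp : 0 < p) (hT : HasSchattenBound p C T) (c : ℂ) :
    HasSchattenBound p (‖c‖ * C) (c • T) := by
  intro n e f he hf
  have h : ∑ i, ‖inner ℂ (f i) ((c • T) (e i))‖ ^ p
      = ‖c‖ ^ p * ∑ i, ‖inner ℂ (f i) (T (e i))‖ ^ p := by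
    rw [Finset.mul_sum]
    refine Finset.sum_congr rfl fun i _ => ?_
    rw [smul_apply, inner_smul_right, norm_mul, Real.mul_rpow (norm_nonneg _) (norm_nonneg _)]
  rw [h, Real.mul_rpow (by positivity) (by positivity), ← Real.rpow_mul (norm_nonneg _),
    mul_one_div_cancel hp.ne', Real.rpow_one]
  exact mul_le_mul_of_nonneg_left (hT n e f he hf) (norm_nonneg _)

lemma neg (hT : HasSchattenBound p C T) : HasSchattenBound p C (-T) := by
  intro n e f he hf
  simpa using hT n e f he hf

lemma of_tendsto (hp : 0 < p) {S : ℕ → H₁ →L[ℂ] H₂} (hS : ∀ n, HasSchattenBound p C (S n))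
    (h : Filter.Tendsto S Filter.atTop (nhds T)) : HasSchattenBound p C T := by
  intro n e f he hf
  refine le_of_tendsto' (x := Filter.atTop)
    (f := fun k => (∑ i, ‖inner ℂ (f i) (S k (e i))‖ ^ p) ^ (1 / p)) ?_
    (fun k => hS k n e f he hf)
  refine Filter.Tendsto.rpow_const (tendsto_finsetSum _ fun i _ => ?_) (Or.inr (by positivity))
  refine Filter.Tendsto.rpow_const (Filter.Tendsto.norm ?_) (Or.inr hp.le)
  exact Filter.Tendsto.inner tendsto_const_nhds
    (((ContinuousLinearMap.apply ℂ H₂ (e i)).continuous.tendsto T).comp h)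

lemma adjoint [CompleteSpace H₁] [CompleteSpace H₂] (hT : HasSchattenBound p C T) :
    HasSchattenBound p C (ContinuousLinearMap.adjoint T) := by
  intro n e f he hf
  convert hT n f e hf he using 4 with i
  rw [ContinuousLinearMap.adjoint_inner_right, ← inner_conj_symm, RCLike.norm_conj]

/-- Compression by isometries does not increase the bound. -/
lemma compress {H₃ H₄ : Type*} [NormedAddCommGroup H₃] [InnerProductSpace ℂ H₃]
    [NormedAddCommGroup H₄] [InnerProductSpace ℂ H₄] (hT : HasSchattenBound p C T)
    (ι : H₃ →ₗᵢ[ℂ] H₁) (κ : H₄ →ₗᵢ[ℂ] H₂) {R : H₃ →L[ℂ] H₄}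
    (hR : ∀ x y, inner ℂ y (R x) = inner ℂ (κ y) (T (ι x))) : HasSchattenBound p C R := by
  intro n e f he hf
  simp only [hR]
  exact hT n (ι ∘ e) (κ ∘ f) (he.comp_linearIsometry ι) (hf.comp_linearIsometry κ)

end HasSchattenBound

end SchattenBound

/-! ### The ideal property of Schatten bounds -/

section SchattenIdeal

variable {H : Type*} [NormedAddCommGroup H] [InnerProductSpace ℂ H] [CompleteSpace H]

namespace HasSchattenBound

variable {p C : ℝ} {T : H →L[ℂ] H}

lemma star_iff : HasSchattenBound p C (star T) ↔ HasSchattenBound p C T :=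
  ⟨fun h => by simpa [ContinuousLinearMap.star_eq_adjoint] using h.adjoint, fun h => h.adjoint⟩

lemma mul_unitary (hT : HasSchattenBound p C T) {u : H →L[ℂ] H} (hu : u ∈ unitary (H →L[ℂ] H)) :
    HasSchattenBound p C (T * u) := by
  refine hT.compress (ContinuousLinearMap.toLinearMap u |>.isometryOfInner fun x y => ?_)
    LinearIsometry.id fun x y => rfl
  have h : star u * u = 1 := (Unitary.mem_iff.1 hu).1
  change inner ℂ (u x) (u y) = _
  rw [← ContinuousLinearMap.adjoint_inner_right, ← ContinuousLinearMap.star_eq_adjoint,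
    ← mul_apply_eq_comp, h, one_apply_eq_self]

/-- A self-adjoint contraction `a` is the average of the unitary `a + i√(1 - a²)` and its adjoint.
Unitary invariance and the triangle inequality therefore suffice, after scaling by `‖b‖`. -/
lemma mul_isSelfAdjoint (hp : 1 ≤ p) (hT : HasSchattenBound p C T) {b : H →L[ℂ] H}
    (hb : IsSelfAdjoint b) : HasSchattenBound p (C * ‖b‖) (T * b) := by
  have hp0 : 0 < p := by linarith
  rcases eq_or_ne b 0 with rfl | hb0
  · simpa using zero hp0
  have hn : ‖b‖ ≠ 0 := norm_ne_zero_iff.2 hb0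
  set a : selfAdjoint (H →L[ℂ] H) :=
    ⟨(‖b‖⁻¹ : ℝ) • b, (IsSelfAdjoint.all (‖b‖⁻¹ : ℝ)).smul hb⟩
  have ha : ‖a‖ ≤ 1 := by
    change ‖(‖b‖⁻¹ : ℝ) • b‖ ≤ 1
    rw [norm_smul, norm_inv, norm_norm, inv_mul_cancel₀ hn]
  set u := selfAdjoint.unitarySelfAddISMul a ha
  have h1 : (u : H →L[ℂ] H) + star (u : H →L[ℂ] H) = (2 : ℂ) • (a : H →L[ℂ] H) := by
    rw [selfAdjoint.star_coe_unitarySelfAddISMul, selfAdjoint.unitarySelfAddISMul_coe, two_smul]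
    abel
  have h2 : T * b = ((‖b‖ / 2 : ℝ) : ℂ) • (T * (u : H →L[ℂ] H) + T * star (u : H →L[ℂ] H)) := by
    rw [← mul_add, h1, mul_smul_comm, smul_smul, ← mul_smul_comm]
    congr 1
    change b = _ • (‖b‖⁻¹ : ℝ) • b
    rw [← Complex.coe_smul, smul_smul]
    have : ((‖b‖ : ℝ) : ℂ) ≠ 0 := by exact_mod_cast hn
    push_cast
    field_simp
    simp
  rw [h2]
  refine (((hT.mul_unitary u.2).add hp (hT.mul_unitary (Unitary.star_mem u.2))).smul hp0 _).mono
    (le_of_eq ?_)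
  rw [Complex.norm_real, Real.norm_of_nonneg (by positivity)]
  ring

lemma isSelfAdjoint_mul (hp : 1 ≤ p) (hT : HasSchattenBound p C T) {b : H →L[ℂ] H}
    (hb : IsSelfAdjoint b) : HasSchattenBound p (C * ‖b‖) (b * T) := by
  rw [← star_iff, star_mul, hb.star_eq]
  exact (star_iff.2 hT).mul_isSelfAdjoint hp hb

lemma exists_mul (hp : 1 ≤ p) (hT : HasSchattenBound p C T) (A : H →L[ℂ] H) :
    ∃ D, HasSchattenBound p D (T * A) := by
  have hp0 : 0 < p := by linarith
  refine ⟨C * ‖((realPart A : selfAdjoint _) : H →L[ℂ] H)‖ +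
    ‖Complex.I‖ * (C * ‖((imaginaryPart A : selfAdjoint _) : H →L[ℂ] H)‖), ?_⟩
  have h := (hT.mul_isSelfAdjoint hp (realPart A).2).add hp
    ((hT.mul_isSelfAdjoint hp (imaginaryPart A).2).smul hp0 Complex.I)
  rwa [← mul_smul_comm, ← mul_add, realPart_add_I_smul_imaginaryPart] at h

lemma exists_mul_left (hp : 1 ≤ p) (hT : HasSchattenBound p C T) (A : H →L[ℂ] H) :
    ∃ D, HasSchattenBound p D (A * T) := by
  obtain ⟨D, hD⟩ := (star_iff.2 hT).exists_mul hp (star A)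
  exact ⟨D, by rwa [← star_mul, star_iff] at hD⟩

end HasSchattenBound

end SchattenIdeal

/-! ### Norm limits of finite rank operators -/

section Approximable

variable {H₁ H₂ H₃ : Type*}
  [NormedAddCommGroup H₁] [InnerProductSpace ℂ H₁]
  [NormedAddCommGroup H₂] [InnerProductSpace ℂ H₂]
  [NormedAddCommGroup H₃] [InnerProductSpace ℂ H₃]

/-- Operators that are norm limits of operators of finite rank. -/
def IsApproximable (T : H₁ →L[ℂ] H₂) : Prop :=
  ∀ ε > 0, ∃ F : H₁ →L[ℂ] H₂, F.toLinearMap.HasFiniteRange ∧ ‖T - F‖ ≤ ε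

namespace IsApproximable

lemma comp_left {T : H₁ →L[ℂ] H₂} (hT : IsApproximable T) (S : H₂ →L[ℂ] H₃) :
    IsApproximable (S ∘L T) := by
  intro ε hε
  obtain ⟨F, hF, h⟩ := hT (ε / (‖S‖ + 1)) (by positivity)
  refine ⟨S ∘L F, hF.comp_left _, ?_⟩
  rw [← ContinuousLinearMap.comp_sub]
  refine (ContinuousLinearMap.opNorm_comp_le _ _).trans ?_
  calc ‖S‖ * ‖T - F‖ ≤ (‖S‖ + 1) * (ε / (‖S‖ + 1)) := by gcongr; linarith
    _ = ε := by field_simp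

lemma comp_right {T : H₂ →L[ℂ] H₃} (hT : IsApproximable T) (S : H₁ →L[ℂ] H₂) :
    IsApproximable (T ∘L S) := by
  intro ε hε
  obtain ⟨F, hF, h⟩ := hT (ε / (‖S‖ + 1)) (by positivity)
  refine ⟨F ∘L S, hF.comp_right _, ?_⟩
  rw [← ContinuousLinearMap.sub_comp]
  refine (ContinuousLinearMap.opNorm_comp_le _ _).trans ?_
  calc ‖T - F‖ * ‖S‖ ≤ (ε / (‖S‖ + 1)) * (‖S‖ + 1) := by gcongr; linarith
    _ = ε := by field_simp

lemma add {S T : H₁ →L[ℂ] H₂} (hS : IsApproximable S) (hT : IsApproximable T) :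
    IsApproximable (S + T) := by
  intro ε hε
  obtain ⟨F, hF, h⟩ := hS (ε / 2) (by positivity)
  obtain ⟨F', hF', h'⟩ := hT (ε / 2) (by positivity)
  refine ⟨F + F', hF.add hF', ?_⟩
  rw [add_sub_add_comm]
  linarith [norm_add_le (S - F) (T - F')]

lemma neg {T : H₁ →L[ℂ] H₂} (hT : IsApproximable T) : IsApproximable (-T) := by
  intro ε hε
  obtain ⟨F, hF, h⟩ := hT ε hε
  exact ⟨-F, hF.neg, by rwa [neg_sub_neg, norm_sub_rev]⟩

lemma isCompactOperator [CompleteSpace H₂] {T : H₁ →L[ℂ] H₂} (hT : IsApproximable T) :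
    IsCompactOperator T := by
  choose F hF h using fun n : ℕ => hT (1 / (n + 1)) (by positivity)
  refine isCompactOperator_of_tendsto (F := F) (l := Filter.atTop) ?_
    (Filter.Eventually.of_forall fun n => ?_)
  · rw [tendsto_iff_norm_sub_tendsto_zero]
    refine squeeze_zero (fun _ => norm_nonneg _) (fun n => ?_) tendsto_one_div_add_atTop_nhds_zero_nat
    rw [norm_sub_rev]
    exact h n
  · have : FiniteDimensional ℂ (F n).range := Module.Finite.of_fg (hF n)
    have h1 : IsCompactOperator ((F n).codRestrict (F n).range fun x => ⟨x, rfl⟩) :=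
      (isCompactOperator_id (E := (F n).range)).comp_clm _
    exact h1.clm_comp (F n).range.subtypeL

end IsApproximable

/-- Greedy choice: each new pair is taken orthogonal to the spans of the previous vectors. -/
lemma exists_orthonormal_inner_gt {T : H₁ →L[ℂ] H₂} {ε : ℝ}
    (h : ∀ (F : Submodule ℂ H₁) (F' : Submodule ℂ H₂), FiniteDimensional ℂ F →
      FiniteDimensional ℂ F' → ∃ x ∈ Fᗮ, ∃ y ∈ F'ᗮ, ‖x‖ = 1 ∧ ‖y‖ = 1 ∧ ε < ‖inner ℂ y (T x)‖)
    (n : ℕ) : ∃ (e : Fin n → H₁) (f : Fin n → H₂), Orthonormal ℂ e ∧ Orthonormal ℂ f ∧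
      ∀ i, ε < ‖inner ℂ (f i) (T (e i))‖ := by
  induction n with
  | zero => exact ⟨Fin.elim0, Fin.elim0, by simp [Orthonormal], by simp [Orthonormal],
      fun i => i.elim0⟩
  | succ n ih =>
    obtain ⟨e, f, he, hf, hef⟩ := ih
    obtain ⟨x, hx, y, hy, hx1, hy1, hxy⟩ := h (Submodule.span ℂ (Set.range e))
      (Submodule.span ℂ (Set.range f)) (FiniteDimensional.span_of_finite ℂ (Set.finite_range e))
      (FiniteDimensional.span_of_finite ℂ (Set.finite_range f))
    refine ⟨Matrix.vecCons x e, Matrix.vecCons y f,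
      orthonormal_vecCons_iff.2 ⟨hx1, fun i => ?_, he⟩,
      orthonormal_vecCons_iff.2 ⟨hy1, fun i => ?_, hf⟩, fun i => ?_⟩
    · exact Submodule.inner_left_of_mem_orthogonal (Submodule.subset_span (Set.mem_range_self i)) hx
    · exact Submodule.inner_left_of_mem_orthogonal (Submodule.subset_span (Set.mem_range_self i)) hy
    · refine Fin.cases ?_ (fun j => ?_) i
      · simpa using hxy
      · simpa using hef j

/-- An operator with small matrix coefficients off finite dimensional subspaces is a small
perturbation of an operator of finite rank. -/
lemma exists_hasFiniteRange_norm_sub_le {T : H₁ →L[ℂ] H₂} {ε : ℝ} (hε : 0 ≤ ε)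
    (F : Submodule ℂ H₁) (F' : Submodule ℂ H₂) [FiniteDimensional ℂ F] [FiniteDimensional ℂ F']
    (h : ∀ x ∈ Fᗮ, ∀ y ∈ F'ᗮ, ‖x‖ = 1 → ‖y‖ = 1 → ‖inner ℂ y (T x)‖ ≤ ε) :
    ∃ R : H₁ →L[ℂ] H₂, R.toLinearMap.HasFiniteRange ∧ ‖T - R‖ ≤ ε := by
  have key : ∀ x ∈ Fᗮ, ∀ y ∈ F'ᗮ, ‖inner ℂ y (T x)‖ ≤ ε * ‖x‖ * ‖y‖ := by
    intro x hx y hy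
    rcases eq_or_ne x 0 with rfl | hx0
    · simp
    rcases eq_or_ne y 0 with rfl | hy0
    · simp
    have hx1 : ‖x‖ ≠ 0 := norm_ne_zero_iff.2 hx0
    have hy1 : ‖y‖ ≠ 0 := norm_ne_zero_iff.2 hy0
    have h1 := h (((‖x‖ : ℂ))⁻¹ • x) (Submodule.smul_mem _ _ hx) (((‖y‖ : ℂ))⁻¹ • y)
      (Submodule.smul_mem _ _ hy) (by simp [norm_smul, hx1]) (by simp [norm_smul, hy1])
    rw [map_smul, inner_smul_left, inner_smul_right, norm_mul, norm_mul, RCLike.norm_conj,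
      norm_inv, norm_inv, Complex.norm_real, Complex.norm_real, norm_norm, norm_norm] at h1
    have hxp : 0 < ‖x‖ := norm_pos_iff.2 hx0
    have hyp : 0 < ‖y‖ := norm_pos_iff.2 hy0
    rw [← mul_assoc, ← mul_inv, inv_mul_le_iff₀ (by positivity)] at h1
    linarith
  set P := F.starProjection
  set P' := F'.starProjection
  have hP : P.toLinearMap.HasFiniteRange := by
    have h1 : (F.orthogonalProjectionOnto : H₁ →L[ℂ] F).toLinearMap.HasFiniteRange :=
      LinearMap.HasFiniteRange.of_isNoetherian_rng
    exact h1.comp_left F.subtype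
  have hP' : P'.toLinearMap.HasFiniteRange := by
    have h1 : (F'.orthogonalProjectionOnto : H₂ →L[ℂ] F').toLinearMap.HasFiniteRange :=
      LinearMap.HasFiniteRange.of_isNoetherian_rng
    exact h1.comp_left F'.subtype
  -- This choice makes the remainder equal to `(1 - P')T(1 - P)`, which only sees coefficients off
  -- `F` and `F'`.
  refine ⟨P' ∘L T + (T - P' ∘L T) ∘L P, (hP'.comp_right T.toLinearMap).add
    (hP.comp_left (T - P' ∘L T).toLinearMap), ?_⟩
  refine ContinuousLinearMap.opNorm_le_bound _ hε fun x => ?_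
  set x' := x - P x
  have hx' : x' ∈ Fᗮ := F.sub_starProjection_mem_orthogonal x
  set z := T x' - P' (T x')
  have hz : z ∈ F'ᗮ := F'.sub_starProjection_mem_orthogonal (T x')
  have hzeq : (T - (P' ∘L T + (T - P' ∘L T) ∘L P)) x = z := by
    simp [z, x']
    abel
  rw [hzeq]
  have h1 : inner ℂ z (T x') = inner ℂ z z := by
    conv_rhs => rw [show z = T x' - P' (T x') from rfl, inner_sub_right]
    rw [Submodule.inner_left_of_mem_orthogonal (F'.starProjection_apply_mem _) hz, sub_zero]
  have h2 := key x' hx' z hz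
  rw [h1, inner_self_eq_norm_sq_to_K, norm_pow, RCLike.norm_ofReal, abs_norm, sq] at h2
  have h3 : ‖z‖ ≤ ε * ‖x'‖ := by
    rcases (norm_nonneg z).eq_or_lt with h0 | h0
    · rw [← h0]; positivity
    · exact le_of_mul_le_mul_right h2 h0
  refine h3.trans (mul_le_mul_of_nonneg_left ?_ hε)
  have h4 : ‖x‖ * ‖x‖ = ‖P x‖ * ‖P x‖ + ‖x'‖ * ‖x'‖ := by
    rw [← norm_add_sq_eq_norm_sq_add_norm_sq_of_inner_eq_zero (P x) x'
      (Submodule.inner_right_of_mem_orthogonal (F.starProjection_apply_mem x) hx')]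
    simp [x']
  nlinarith [norm_nonneg x, norm_nonneg x', norm_nonneg (P x), mul_self_nonneg ‖P x‖]

/-- Otherwise, for every `n` there are `n` orthonormal pairs with coefficients above `ε`, so that `n
ε^p ≤ C^p` for all `n`. -/
lemma HasSchattenBound.isApproximable {p C : ℝ} (hp : 0 < p) {T : H₁ →L[ℂ] H₂}
    (hT : HasSchattenBound p C T) : IsApproximable T := by
  intro ε hε
  by_contra hcon
  have h : ∀ (F : Submodule ℂ H₁) (F' : Submodule ℂ H₂), FiniteDimensional ℂ F →
      FiniteDimensional ℂ F' →
      ∃ x ∈ Fᗮ, ∃ y ∈ F'ᗮ, ‖x‖ = 1 ∧ ‖y‖ = 1 ∧ ε < ‖inner ℂ y (T x)‖ := by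
    intro F F' _ _
    by_contra! h
    exact hcon (exists_hasFiniteRange_norm_sub_le hε.le F F' h)
  obtain ⟨n, hn⟩ := exists_nat_gt (C ^ p / ε ^ p)
  obtain ⟨e, f, he, hf, hef⟩ := exists_orthonormal_inner_gt h n
  have h1 : (n : ℝ) * ε ^ p ≤ C ^ p := by
    refine le_trans ?_ (hT.sum_le hp he hf)
    calc (n : ℝ) * ε ^ p = ∑ _i : Fin n, ε ^ p := by simp
      _ ≤ _ := Finset.sum_le_sum fun i _ => Real.rpow_le_rpow hε.le (hef i).le hp.le
  rw [div_lt_iff₀ (by positivity)] at hn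
  linarith

end Approximable

/-! ### Functional calculus on eigenvectors and Jensen's inequality -/

section FunctionalCalculus

variable {H : Type*} [NormedAddCommGroup H] [InnerProductSpace ℂ H] [CompleteSpace H]

/-- True for constants and the identity function, stable under sums, products and uniform limits,
hence true by Stone–Weierstrass. -/
lemma cfc_apply_of_apply_eq_smul {a : H →L[ℂ] H} (ha : IsSelfAdjoint a) {x : H} {r : ℝ}
    (hx : a x = r • x) {f : ℝ → ℝ} (hf : ContinuousOn f (spectrum ℝ a)) :
    cfc f a x = f r • x := by
  rcases eq_or_ne x 0 with rfl | hx0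
  · simp
  have hr : r ∈ spectrum ℝ a := by
    rw [spectrum.mem_iff]
    intro hu
    obtain ⟨b, hb⟩ := hu.exists_left_inv
    apply hx0
    have h1 : (b * (algebraMap ℝ (H →L[ℂ] H) r - a)) x = x := by rw [hb, one_apply_eq_self]
    rw [← h1, mul_apply_eq_comp, sub_apply, hx, Algebra.algebraMap_eq_smul_one, smul_apply,
      one_apply_eq_self, sub_self, map_zero]
  rw [cfc_apply f a ha hf]
  have key : ∀ g : C(spectrum ℝ a, ℝ), cfcHom ha g x = g ⟨r, hr⟩ • x := by
    intro g
    induction g using ContinuousMap.induction_on_of_compact with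
    | const c =>
      have : ContinuousMap.const (spectrum ℝ a) c
          = algebraMap ℝ C(spectrum ℝ a, ℝ) c := rfl
      rw [this, AlgHomClass.commutes, Algebra.algebraMap_eq_smul_one, smul_apply,
        one_apply_eq_self]
      rfl
    | id =>
      rw [cfcHom_id ha, hx]
      rfl
    | star_id =>
      rw [map_star, cfcHom_id ha, ha.star_eq, hx]
      rfl
    | add g g' hg hg' => rw [map_add, add_apply, hg, hg', ContinuousMap.add_apply, add_smul]
    | mul g g' hg hg' =>
      rw [map_mul, mul_apply_eq_comp, hg', ContinuousLinearMap.map_smul_of_tower, hg, ContinuousMap.mul_apply, smul_smul,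
        mul_comm]
    | frequently g h =>
      have hcl : IsClosed {g : C(spectrum ℝ a, ℝ) | cfcHom ha g x = g ⟨r, hr⟩ • x} := by
        refine isClosed_eq ?_ (by fun_prop)
        exact (ContinuousLinearMap.apply ℂ H x).continuous.comp (cfcHom_continuous ha)
      exact hcl.mem_of_frequently_of_tendsto h Filter.tendsto_id
  exact key _

lemma isStrictlyPositive_smul_one_add {r : ℝ} (hr : 0 < r) {a : H →L[ℂ] H} (ha : 0 ≤ a) :
    IsStrictlyPositive (r • (1 : H →L[ℂ] H) + a) := by
  have h : IsStrictlyPositive (r • (1 : H →L[ℂ] H)) :=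
    IsStrictlyPositive.smul hr isStrictlyPositive_one
  exact h.add_nonneg ha

lemma re_inner_nonneg_of_nonneg {a : H →L[ℂ] H} (ha : 0 ≤ a) (x : H) :
    0 ≤ RCLike.re (inner ℂ x (a x)) :=
  (RCLike.nonneg_iff.1
    (((ContinuousLinearMap.nonneg_iff_isPositive a).1 ha).inner_nonneg_right x)).1

lemma re_inner_le_of_le {a b : H →L[ℂ] H} (h : a ≤ b) (x : H) :
    RCLike.re (inner ℂ x (a x)) ≤ RCLike.re (inner ℂ x (b x)) := by
  have := re_inner_nonneg_of_nonneg (sub_nonneg.2 h) x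
  rw [sub_apply, inner_sub_right, map_sub] at this
  linarith

/-- The tangent at `s` lies below the convex function `t ^ p`; after rescaling this is Bernoulli's
inequality. -/
lemma rpow_tangent_le {p s t : ℝ} (hp : 1 ≤ p) (hs : 0 ≤ s) (ht : 0 ≤ t) :
    (1 - p) * s ^ p + p * s ^ (p - 1) * t ≤ t ^ p := by
  rcases hs.eq_or_lt with rfl | hs
  · rcases hp.eq_or_lt with rfl | hp
    · simp
    · rw [Real.zero_rpow (by linarith), Real.zero_rpow (by linarith)]
      simp only [mul_zero, zero_mul, add_zero]
      positivity
  have h := one_add_mul_self_le_rpow_one_add (s := t / s - 1) (by linarith [div_nonneg ht hs.le]) hp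
  rw [add_sub_cancel, Real.div_rpow ht hs.le, le_div_iff₀ (by positivity)] at h
  rw [Real.rpow_sub_one hs.ne']
  refine le_of_eq_of_le ?_ h
  field_simp
  ring

/-- Jensen's inequality for the power functions on positive operators. -/
lemma re_inner_rpow_le {a : H →L[ℂ] H} (ha : 0 ≤ a) {p : ℝ} (hp : 1 ≤ p) {x : H} (hx : ‖x‖ ≤ 1) :
    RCLike.re (inner ℂ x (a x)) ^ p ≤ RCLike.re (inner ℂ x ((a ^ p) x)) := by
  set s := RCLike.re (inner ℂ x (a x))
  have hs : 0 ≤ s := re_inner_nonneg_of_nonneg ha x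
  have hsa : IsSelfAdjoint a := ha.isSelfAdjoint
  -- The tangent is taken at the mean value `s = ⟨x, a x⟩`. Its constant term has the factor `1 - p
  -- ≤ 0`, so `‖x‖ ≤ 1` is enough in place of `‖x‖ = 1`.
  have h1 : ((1 - p) * s ^ p) • (1 : H →L[ℂ] H) + (p * s ^ (p - 1)) • a ≤ a ^ p := by
    rw [CFC.rpow_eq_cfc_real ha]
    have h2 : ((1 - p) * s ^ p) • (1 : H →L[ℂ] H) + (p * s ^ (p - 1)) • a
        = cfc (fun t : ℝ => (1 - p) * s ^ p + p * s ^ (p - 1) * t) a := by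
      rw [cfc_const_add _ _ a, cfc_const_mul _ _ a, cfc_id' ℝ a, Algebra.algebraMap_eq_smul_one]
    rw [h2]
    refine cfc_mono (fun t ht => rpow_tangent_le hp hs (spectrum_nonneg_of_nonneg ha ht))
      (by fun_prop) ?_
    exact (Real.continuous_rpow_const (by linarith)).continuousOn
  refine le_trans ?_ (re_inner_le_of_le h1 x)
  rw [add_apply, smul_apply, smul_apply, one_apply_eq_self, inner_add_right, map_add,
    inner_smul_right_eq_smul, inner_smul_right_eq_smul, RCLike.smul_re, RCLike.smul_re,
    inner_self_eq_norm_sq]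
  have h3 : p * s ^ (p - 1) * s = p * s ^ p := by
    rcases hs.eq_or_lt with h0 | h0
    · rw [← h0, Real.zero_rpow (by linarith : p ≠ 0)]; simp
    · rw [Real.rpow_sub_one h0.ne']; field_simp
  have h4 : 0 ≤ s ^ p := by positivity
  have h5 : ‖x‖ ^ 2 ≤ 1 := by nlinarith [norm_nonneg x]
  change _ ≤ (1 - p) * s ^ p * ‖x‖ ^ 2 + p * s ^ (p - 1) * s
  rw [h3]
  nlinarith [mul_nonneg (mul_nonneg (sub_nonneg.2 hp) h4) (sub_nonneg.2 h5)]

lemma norm_inner_apply_le {a : H →L[ℂ] H} (ha : 0 ≤ a) (x y : H) :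
    ‖inner ℂ y (a x)‖ ≤ √(RCLike.re (inner ℂ y (a y))) * √(RCLike.re (inner ℂ x (a x))) := by
  have hs : ContinuousLinearMap.adjoint (CFC.sqrt a) = CFC.sqrt a :=
    (CFC.sqrt_nonneg a).isSelfAdjoint.star_eq
  have h : ∀ u v, inner ℂ u (a v) = inner ℂ (CFC.sqrt a u) (CFC.sqrt a v) := by
    intro u v
    conv_lhs => rw [← CFC.sqrt_mul_sqrt_self a ha]
    rw [mul_apply_eq_comp, ← ContinuousLinearMap.adjoint_inner_left, hs]
  rw [h, h, h, inner_self_eq_norm_sq, inner_self_eq_norm_sq, Real.sqrt_sq (norm_nonneg _),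
    Real.sqrt_sq (norm_nonneg _)]
  exact norm_inner_le_norm _ _

/-- Cauchy–Schwarz for the form of `a`, then Jensen and the arithmetic-geometric mean inequality.
This trades off-diagonal coefficients of `a` for diagonal ones of `a ^ p`, which the trace controls.
-/
lemma norm_inner_rpow_le {a : H →L[ℂ] H} (ha : 0 ≤ a) {p : ℝ} (hp : 1 ≤ p) {x y : H}
    (hx : ‖x‖ ≤ 1) (hy : ‖y‖ ≤ 1) :
    2 * ‖inner ℂ y (a x)‖ ^ p ≤
      RCLike.re (inner ℂ y ((a ^ p) y)) + RCLike.re (inner ℂ x ((a ^ p) x)) := by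
  set s := RCLike.re (inner ℂ x (a x))
  set t := RCLike.re (inner ℂ y (a y))
  have hs : 0 ≤ s := re_inner_nonneg_of_nonneg ha x
  have ht : 0 ≤ t := re_inner_nonneg_of_nonneg ha y
  have h1 : ‖inner ℂ y (a x)‖ ^ p ≤ (√t) ^ p * (√s) ^ p := by
    rw [← Real.mul_rpow (by positivity) (by positivity)]
    exact Real.rpow_le_rpow (norm_nonneg _) (norm_inner_apply_le ha x y) (by linarith)
  have h2 : ∀ r : ℝ, 0 ≤ r → ((√r) ^ p) ^ 2 = r ^ p := by
    intro r hr
    rw [← Real.rpow_natCast, ← Real.rpow_mul (by positivity), mul_comm,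
      Real.rpow_mul (by positivity), Real.rpow_natCast, Real.sq_sqrt hr]
  have h3 := re_inner_rpow_le ha hp hx
  have h4 := re_inner_rpow_le ha hp hy
  nlinarith [sq_nonneg ((√t) ^ p - (√s) ^ p), h2 s hs, h2 t ht]

end FunctionalCalculus

/-! ### The trace definition of the Schatten class agrees with Schatten bounds -/

section Abs

variable {H₁ H₂ : Type*}
  [NormedAddCommGroup H₁] [InnerProductSpace ℂ H₁] [CompleteSpace H₁]
  [NormedAddCommGroup H₂] [InnerProductSpace ℂ H₂] [CompleteSpace H₂]

lemma adjoint_comp_self_nonneg (T : H₁ →L[ℂ] H₂) : 0 ≤ ContinuousLinearMap.adjoint T ∘L T :=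
  (ContinuousLinearMap.nonneg_iff_isPositive _).2
    (ContinuousLinearMap.isPositive_adjoint_comp_self T)

lemma operatorAbs_nonneg (T : H₁ →L[ℂ] H₂) : 0 ≤ operatorAbs T := CFC.sqrt_nonneg _

lemma operatorAbs_mul_self (T : H₁ →L[ℂ] H₂) :
    operatorAbs T * operatorAbs T = ContinuousLinearMap.adjoint T ∘L T :=
  CFC.sqrt_mul_sqrt_self _ (adjoint_comp_self_nonneg T)

lemma norm_operatorAbs_apply (T : H₁ →L[ℂ] H₂) (x : H₁) : ‖operatorAbs T x‖ = ‖T x‖ := by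
  have h1 : ‖operatorAbs T x‖ ^ 2 = ‖T x‖ ^ 2 := by
    rw [← inner_self_eq_norm_sq (𝕜 := ℂ), ← inner_self_eq_norm_sq (𝕜 := ℂ),
      ← ContinuousLinearMap.adjoint_inner_right, ← ContinuousLinearMap.adjoint_inner_right,
      ← ContinuousLinearMap.star_eq_adjoint, (operatorAbs_nonneg T).isSelfAdjoint.star_eq,
      ← mul_apply_eq_comp, operatorAbs_mul_self]
    rfl
  exact (sq_eq_sq₀ (norm_nonneg _) (norm_nonneg _)).1 h1

/-- Every operator is, up to `ε`, the product of a contraction and its absolute value. -/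
lemma exists_contraction_norm_sub_le (T : H₁ →L[ℂ] H₂) {ε : ℝ} (hε : 0 < ε) :
    ∃ V : H₁ →L[ℂ] H₂, ‖V‖ ≤ 1 ∧ ‖T - V ∘L operatorAbs T‖ ≤ ε := by
  set a := operatorAbs T
  have ha : 0 ≤ a := operatorAbs_nonneg T
  -- With `V = T(|T| + ε)⁻¹` the error `T - V|T|` is exactly `εV`. It is a contraction because `‖T
  -- y‖ = ‖|T| y‖ ≤ ‖(|T| + ε) y‖`.
  have hpos : IsStrictlyPositive (a + ε • (1 : H₁ →L[ℂ] H₁)) := by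
    rw [add_comm]
    exact isStrictlyPositive_smul_one_add hε ha
  obtain ⟨R, hR, -⟩ := isUnit_iff_exists.1 hpos.isUnit
  have hV : ‖T ∘L R‖ ≤ 1 := by
    refine ContinuousLinearMap.opNorm_le_bound _ zero_le_one fun x => ?_
    have hx : x = a (R x) + ε • R x := by
      conv_lhs => rw [← one_apply_eq_self (F := H₁ →L[ℂ] H₁) x, ← hR]
      simp
    have h1 : ‖x‖ ^ 2 = ‖a (R x)‖ ^ 2 + 2 * (ε * RCLike.re (inner ℂ (R x) (a (R x))))
        + ‖ε • R x‖ ^ 2 := by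
      conv_lhs => rw [hx]
      rw [norm_add_sq (𝕜 := ℂ), inner_smul_right_eq_smul, RCLike.smul_re, ← inner_conj_symm,
        RCLike.conj_re]
    have h2 := re_inner_nonneg_of_nonneg ha (R x)
    rw [ContinuousLinearMap.comp_apply, ← norm_operatorAbs_apply, one_mul]
    refine le_of_sq_le_sq ?_ (norm_nonneg _)
    rw [h1]
    have := mul_nonneg hε.le h2
    nlinarith [sq_nonneg ‖ε • R x‖]
  refine ⟨T ∘L R, hV, ?_⟩
  have hRa : R * (a + ε • (1 : H₁ →L[ℂ] H₁)) = 1 := by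
    have hu := hpos.isUnit
    exact (hu.mul_right_inj.1 (by rw [← mul_assoc, hR, one_mul, mul_one]))
  have h3 : T - (T ∘L R) ∘L a = ε • (T ∘L R) := by
    have h4 : R * a = 1 - ε • R := by
      rw [mul_add, mul_smul_comm, mul_one] at hRa
      exact eq_sub_of_add_eq hRa
    have h5 : (T ∘L R) ∘L a = T ∘L (R * a) := rfl
    rw [h5, h4]
    ext x
    simp
  rw [h3, norm_smul, Real.norm_of_nonneg hε.le]
  nlinarith

/-- Parseval in `b`, exchange of sums, then Bessel for `f`. -/
lemma sum_enorm_sq_le_tsum_adjoint {ι : Type*} (b : HilbertBasis ι ℂ H₁) {n : ℕ} {f : Fin n → H₂}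
    (hf : Orthonormal ℂ f) (S : H₂ →L[ℂ] H₁) :
    ∑ i, ‖S (f i)‖ₑ ^ 2 ≤ ∑' j, ‖ContinuousLinearMap.adjoint S (b j)‖ₑ ^ 2 := by
  calc ∑ i, ‖S (f i)‖ₑ ^ 2 = ∑ i, ∑' j, ‖inner ℂ (b j) (S (f i))‖ₑ ^ 2 := by
        simp only [tsum_enorm_inner_sq]
    _ = ∑' j, ∑ i, ‖inner ℂ (b j) (S (f i))‖ₑ ^ 2 :=
        (Summable.tsum_finsetSum fun _ _ => ENNReal.summable).symm
    _ ≤ ∑' j, ‖ContinuousLinearMap.adjoint S (b j)‖ₑ ^ 2 := by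
        refine ENNReal.tsum_le_tsum fun j => ?_
        have h := hf.sum_inner_products_le (ContinuousLinearMap.adjoint S (b j))
          (s := Finset.univ)
        have h' := ENNReal.ofReal_le_ofReal h
        rw [ENNReal.ofReal_sum_of_nonneg fun _ _ => by positivity] at h'
        simp only [ENNReal.ofReal_pow (norm_nonneg _), ofReal_norm] at h'
        refine le_of_eq_of_le (Finset.sum_congr rfl fun i _ => ?_) h'
        rw [ContinuousLinearMap.adjoint_inner_right, ← inner_conj_symm, ← ofReal_norm,
          ← ofReal_norm, RCLike.norm_conj]

/-- The vectors `V* fᵢ` need not be orthonormal. With `B = √A` the sum is `∑ ‖B V* fᵢ‖²`, at most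
the squared Hilbert–Schmidt norm of `VB`, hence of `B`. -/
lemma sum_re_inner_le_positiveTrace {A : H₁ →L[ℂ] H₁} (hA : 0 ≤ A) (hfin : positiveTrace A < ∞)
    {V : H₁ →L[ℂ] H₂} (hV : ‖V‖ ≤ 1) {n : ℕ} {f : Fin n → H₂} (hf : Orthonormal ℂ f) :
    ∑ i, RCLike.re (inner ℂ (ContinuousLinearMap.adjoint V (f i))
      (A (ContinuousLinearMap.adjoint V (f i)))) ≤ (positiveTrace A).toReal := by
  set B := CFC.sqrt A
  have hB : star B = B := (CFC.sqrt_nonneg A).isSelfAdjoint.star_eq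
  have hBA : star B * B = A := by rw [hB]; exact CFC.sqrt_mul_sqrt_self A hA
  obtain ⟨w, b, -⟩ := exists_hilbertBasis ℂ H₁
  have h1 : positiveTrace A = ∑' j, ‖B (b j)‖ₑ ^ 2 := by
    rw [← diagonalSum_eq_positiveTrace b hA, ← diagonalSum_eq_tsum_enorm_sq, hBA]
  have h2 := sum_enorm_sq_le_tsum_adjoint b hf (B ∘L ContinuousLinearMap.adjoint V)
  have h3 : ∑ i, ‖(B ∘L ContinuousLinearMap.adjoint V) (f i)‖ₑ ^ 2 ≤ positiveTrace A := by
    rw [h1]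
    refine h2.trans (ENNReal.tsum_le_tsum fun j => ?_)
    rw [ContinuousLinearMap.adjoint_comp, ContinuousLinearMap.adjoint_adjoint,
      ← ContinuousLinearMap.star_eq_adjoint B, hB]
    gcongr
    rw [← ofReal_norm, ← ofReal_norm]
    refine ENNReal.ofReal_le_ofReal ((V.le_opNorm _).trans ?_)
    exact mul_le_of_le_one_left (norm_nonneg _) hV
  have h4 : ∀ y, RCLike.re (inner ℂ y (A y)) = ‖B y‖ ^ 2 := by
    intro y
    rw [← hBA, mul_apply_eq_comp, ContinuousLinearMap.star_eq_adjoint,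
      ContinuousLinearMap.adjoint_inner_right, inner_self_eq_norm_sq]
  simp only [h4]
  rw [← ENNReal.ofReal_le_iff_le_toReal hfin.ne, ENNReal.ofReal_sum_of_nonneg fun _ _ => by positivity]
  simp only [ENNReal.ofReal_pow (norm_nonneg _), ofReal_norm]
  exact h3

/-- For `V_k|T|` in place of `T`, `norm_inner_rpow_le` applied to `eᵢ` and `V_k* fᵢ` bounds twice
the sum by two sums, each at most the trace of `|T|^p`. The bound survives the limit in `k`. -/
lemma hasSchattenBound_of_mem_schattenClass {p : ℝ} (hp : 1 ≤ p) {T : H₁ →L[ℂ] H₂}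
    (hT : T ∈ schattenClass p) :
    HasSchattenBound p ((positiveTrace (operatorAbs T ^ p)).toReal ^ (1 / p)) T := by
  have hp0 : 0 < p := by linarith
  refine HasSchattenBound.of_sum_le hp0 fun n e f he hf => ?_
  set a := operatorAbs T
  have ha : 0 ≤ a := operatorAbs_nonneg T
  choose V hV hTV using fun k : ℕ =>
    exists_contraction_norm_sub_le T (ε := 1 / ((k : ℝ) + 1)) (by positivity)
  have hlim : Filter.Tendsto (fun k => V k ∘L a) Filter.atTop (nhds T) := by
    rw [tendsto_iff_norm_sub_tendsto_zero]
    refine squeeze_zero (fun _ => norm_nonneg _) (fun k => ?_)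
      tendsto_one_div_add_atTop_nhds_zero_nat
    rw [norm_sub_rev]
    exact hTV k
  refine le_of_tendsto' (x := Filter.atTop)
    (f := fun k => ∑ i, ‖inner ℂ (f i) ((V k ∘L a) (e i))‖ ^ p) ?_ fun k => ?_
  · refine tendsto_finsetSum _ fun i _ => ?_
    refine Filter.Tendsto.rpow_const (Filter.Tendsto.norm ?_) (Or.inr hp0.le)
    exact Filter.Tendsto.inner tendsto_const_nhds
      (((ContinuousLinearMap.apply ℂ H₂ (e i)).continuous.tendsto T).comp hlim)
  · have hA : 0 ≤ a ^ p := CFC.rpow_nonneg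
    have h1 := sum_re_inner_le_positiveTrace hA hT (hV k) hf
    have h2 := sum_re_inner_le_positiveTrace hA hT
      (ContinuousLinearMap.norm_id_le (𝕜 := ℂ) (E := H₁)) he
    simp only [ContinuousLinearMap.adjoint_id, ContinuousLinearMap.id_apply] at h2
    have h3 : ∑ i, 2 * ‖inner ℂ (f i) ((V k ∘L a) (e i))‖ ^ p ≤
        ∑ i, (RCLike.re (inner ℂ (ContinuousLinearMap.adjoint (V k) (f i))
          ((a ^ p) (ContinuousLinearMap.adjoint (V k) (f i))))
          + RCLike.re (inner ℂ (e i) ((a ^ p) (e i)))) := by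
      refine Finset.sum_le_sum fun i _ => ?_
      rw [ContinuousLinearMap.comp_apply, ← ContinuousLinearMap.adjoint_inner_left]
      refine norm_inner_rpow_le ha hp (he.1 i).le ?_
      refine (ContinuousLinearMap.le_opNorm _ _).trans ?_
      rw [hf.1 i, mul_one, LinearIsometryEquiv.norm_map]
      exact hV k
    rw [Finset.sum_add_distrib, ← Finset.mul_sum] at h3
    linarith

lemma HasSchattenBound.sum_finset_le {p C : ℝ} (hp : 0 < p) {T : H₁ →L[ℂ] H₂}
    (hT : HasSchattenBound p C T) {ι : Type*} {s : Finset ι} {e : ι → H₁} {f : ι → H₂}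
    (he : Orthonormal ℂ fun i : s => e i) (hf : Orthonormal ℂ fun i : s => f i) :
    ∑ i ∈ s, ‖inner ℂ (f i) (T (e i))‖ ^ p ≤ C ^ p := by
  have h := hT.sum_le hp (he.comp _ s.equivFin.symm.injective)
    (hf.comp _ s.equivFin.symm.injective)
  simp only [Function.comp_apply] at h
  rw [s.equivFin.symm.sum_comp (fun i : s => ‖inner ℂ (f i) (T (e i))‖ ^ p),
    Finset.sum_coe_sort s (fun i => ‖inner ℂ (f i) (T (e i))‖ ^ p)] at h
  exact h

/-- Spectral theorem: the eigenspaces are orthogonal with dense sum, so Hilbert bases of them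
combine to one of `H`. -/
lemma exists_hilbertBasis_eigenvectors.{u} {H : Type u} [NormedAddCommGroup H]
    [InnerProductSpace ℂ H] [CompleteSpace H] {A : H →L[ℂ] H} (hA : IsCompactOperator A)
    (hsa : IsSelfAdjoint A) :
    ∃ (ι : Type u) (b : HilbertBasis ι ℂ H), ∀ i, ∃ μ : ℂ, A (b i) = μ • b i := by
  have hsym : A.toLinearMap.IsSymmetric := hsa.isSymmetric
  have hcomplete : ∀ μ : ℂ, CompleteSpace (Module.End.eigenspace A.toLinearMap μ) := fun μ => by
    have hcl : IsClosed (Module.End.eigenspace A.toLinearMap μ : Set H) := by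
      have : (Module.End.eigenspace A.toLinearMap μ : Set H) = {x | A x = μ • x} := by
        ext x
        exact Module.End.mem_eigenspace_iff
      rw [this]
      exact isClosed_eq A.continuous (continuous_const_smul μ)
    exact hcl.completeSpace_coe
  choose w c hc using fun μ : ℂ =>
    exists_hilbertBasis ℂ (Module.End.eigenspace A.toLinearMap μ)
  have ho := hsym.orthogonalFamily_eigenspaces.orthonormal_sigma_orthonormal
    (v_family := fun μ i => c μ i) fun μ => (c μ).orthonormal
  refine ⟨Σ μ : ℂ, w μ, HilbertBasis.mkOfOrthogonalEqBot ho ?_, fun i => ⟨i.1, ?_⟩⟩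
  · rw [eq_bot_iff, ← ContinuousLinearMap.orthogonalComplement_iSup_eigenspaces_eq_bot hA hsym,
      ← Submodule.iInf_orthogonal]
    refine fun x hx => Submodule.mem_iInf _ |>.2 fun μ => ?_
    rw [← Submodule.orthogonalProjectionOnto_eq_zero_iff]
    have h1 := tsum_enorm_inner_sq (c μ)
      ((Module.End.eigenspace A.toLinearMap μ).orthogonalProjectionOnto x)
    have h2 : ∀ i, inner ℂ (c μ i)
        ((Module.End.eigenspace A.toLinearMap μ).orthogonalProjectionOnto x) = 0 := fun i => by
      rw [Submodule.inner_orthogonalProjectionOnto_eq_of_mem_left]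
      exact Submodule.inner_right_of_mem_orthogonal
        (Submodule.subset_span (Set.mem_range_self (⟨μ, i⟩ : Σ μ : ℂ, w μ))) hx
    simp only [h2, enorm_zero, ne_eq, OfNat.ofNat_ne_zero, not_false_eq_true, zero_pow,
      tsum_zero] at h1
    simpa using h1.symm
  · rw [HilbertBasis.coe_mkOfOrthogonalEqBot]
    exact Module.End.mem_eigenspace_iff.1 (c i.1 i.2).2

/-- The bound makes `T*T` compact, so it has an eigenbasis `b`. There `|T|^p` has the eigenvalues
`‖T bᵢ‖^p`, and the nonzero `T bᵢ`, pairwise orthogonal, normalize to the second family. -/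
lemma HasSchattenBound.mem_schattenClass {p C : ℝ} (hp : 1 ≤ p) {T : H₁ →L[ℂ] H₂}
    (hT : HasSchattenBound p C T) : T ∈ schattenClass p := by
  have hp0 : 0 < p := by linarith
  set A := ContinuousLinearMap.adjoint T ∘L T
  have hA : 0 ≤ A := adjoint_comp_self_nonneg T
  obtain ⟨ι, b, hb⟩ := exists_hilbertBasis_eigenvectors
    ((hT.isApproximable hp0).comp_left (ContinuousLinearMap.adjoint T)).isCompactOperator
    hA.isSelfAdjoint
  have hin : ∀ x y, inner ℂ (T x) (T y) = inner ℂ x (A y) := fun x y => by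
    rw [ContinuousLinearMap.comp_apply, ContinuousLinearMap.adjoint_inner_right]
  have hAb : ∀ i, A (b i) = (‖T (b i)‖ * ‖T (b i)‖ : ℝ) • b i := by
    intro i
    obtain ⟨μ, hμ⟩ := hb i
    have h1 := hin (b i) (b i)
    rw [hμ, inner_smul_right, inner_self_eq_norm_sq_to_K, inner_self_eq_norm_sq_to_K,
      b.orthonormal.1 i] at h1
    simp only [map_one, one_pow, mul_one] at h1
    rw [hμ, ← h1, ← sq, ← Complex.coe_smul]
    push_cast
    rfl
  have habs : ∀ i, operatorAbs T (b i) = ‖T (b i)‖ • b i := by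
    intro i
    rw [operatorAbs, CFC.sqrt_eq_real_sqrt A hA, cfcₙ_eq_cfc,
      cfc_apply_of_apply_eq_smul hA.isSelfAdjoint (hAb i) Real.continuous_sqrt.continuousOn,
      Real.sqrt_mul_self (norm_nonneg _)]
  have hpow : ∀ i, (operatorAbs T ^ p) (b i) = (‖T (b i)‖ ^ p) • b i := by
    intro i
    rw [CFC.rpow_eq_cfc_real (operatorAbs_nonneg T)]
    exact cfc_apply_of_apply_eq_smul (operatorAbs_nonneg T).isSelfAdjoint (habs i)
      (Real.continuous_rpow_const hp0.le).continuousOn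
  change positiveTrace (operatorAbs T ^ p) < ∞
  rw [← diagonalSum_eq_positiveTrace b CFC.rpow_nonneg, diagonalSum, ENNReal.tsum_eq_iSup_sum]
  refine lt_of_le_of_lt (iSup_le fun s => ?_) (ENNReal.ofReal_lt_top (r := C ^ p))
  have hterm : ∀ i, RCLike.re (inner ℂ (b i) ((operatorAbs T ^ p) (b i))) = ‖T (b i)‖ ^ p := by
    intro i
    rw [hpow, inner_smul_right_eq_smul, RCLike.smul_re, inner_self_eq_norm_sq,
      b.orthonormal.1 i]
    simp
  simp only [hterm]
  rw [← ENNReal.ofReal_sum_of_nonneg fun _ _ => by positivity]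
  refine ENNReal.ofReal_le_ofReal ?_
  classical
  set t := s.filter fun i => T (b i) ≠ 0
  have hsum : ∑ i ∈ s, ‖T (b i)‖ ^ p = ∑ i ∈ t, ‖T (b i)‖ ^ p := by
    refine (Finset.sum_filter_of_ne (p := fun i => T (b i) ≠ 0) fun i _ h h0 => h ?_).symm
    rw [h0, norm_zero, Real.zero_rpow hp0.ne']
  have hne : ∀ i : t, (‖T (b i)‖ : ℂ) ≠ 0 := fun i => by
    simpa using (Finset.mem_filter.1 i.2).2
  rw [hsum]
  refine le_of_eq_of_le (Finset.sum_congr rfl fun i hi => ?_) (hT.sum_finset_le hp0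
    (e := b) (f := fun i => (‖T (b i)‖ : ℂ)⁻¹ • T (b i)) (s := t)
    (b.orthonormal.comp _ Subtype.val_injective) ⟨fun i => ?_, fun i j hij => ?_⟩)
  · have h0 : (‖T (b i)‖ : ℂ) ≠ 0 := hne ⟨i, hi⟩
    rw [inner_smul_left, inner_self_eq_norm_sq_to_K, map_inv₀, Complex.conj_ofReal, RCLike.ofReal_eq_complex_ofReal, sq,
      inv_mul_cancel_left₀ h0, Complex.norm_real, norm_norm]
  · have h0 := hne i
    rw [norm_smul, norm_inv, Complex.norm_real, norm_norm]
    exact inv_mul_cancel₀ (by exact_mod_cast h0)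
  · change inner ℂ ((‖T (b i)‖ : ℂ)⁻¹ • T (b i)) ((‖T (b j)‖ : ℂ)⁻¹ • T (b j)) = 0
    rw [inner_smul_left, inner_smul_right, hin, hAb, inner_smul_right_eq_smul,
      b.orthonormal.2 (fun h => hij (Subtype.ext h))]
    simp

end Abs

/-! ### The Sylvester equation with a strictly positive coefficient -/

section Sylvester

variable {H : Type*} [NormedAddCommGroup H] [InnerProductSpace ℂ H] [CompleteSpace H]

lemma IsStrictlyPositive.exists_pos_algebraMap_le {a : H →L[ℂ] H} (ha : IsStrictlyPositive a) :
    ∃ r : ℝ, 0 < r ∧ algebraMap ℝ (H →L[ℂ] H) r ≤ a := by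
  rcases subsingleton_or_nontrivial (H →L[ℂ] H) with _ | _
  · exact ⟨1, one_pos, (Subsingleton.elim _ _).le⟩
  · exact (CFC.exists_pos_algebraMap_le_iff ha.isSelfAdjoint).2 fun x hx => ha.spectrum_pos hx

/-- If `r ≤ a` and `c = ‖a‖ + r`, then `0 ≤ c - a ≤ ‖a‖ < c`; take `b = (c - a)/c`. -/
lemma IsStrictlyPositive.exists_eq_smul_one_sub {a : H →L[ℂ] H} (ha : IsStrictlyPositive a) :
    ∃ c : ℝ, 0 < c ∧ ∃ b : H →L[ℂ] H, IsSelfAdjoint b ∧ ‖b‖ < 1 ∧ a = (c : ℂ) • (1 - b) := by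
  obtain ⟨r, hr, hra⟩ := ha.exists_pos_algebraMap_le
  set c := ‖a‖ + r
  have hc : 0 < c := by positivity
  have hac : a ≤ algebraMap ℝ (H →L[ℂ] H) c := by
    refine (IsSelfAdjoint.le_algebraMap_norm_self (a := a) ha.isSelfAdjoint).trans ?_
    exact algebraMap_mono _ (by simp only [c]; linarith)
  have hb0 : 0 ≤ algebraMap ℝ (H →L[ℂ] H) c - a := sub_nonneg.2 hac
  have hbn : ‖algebraMap ℝ (H →L[ℂ] H) c - a‖ ≤ ‖a‖ := by
    rw [CStarAlgebra.norm_le_iff_le_algebraMap _ (norm_nonneg a) hb0, sub_le_iff_le_add]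
    have : c = ‖a‖ + r := rfl
    rw [this, map_add]
    gcongr
  refine ⟨c, hc, (c⁻¹ : ℝ) • (algebraMap ℝ (H →L[ℂ] H) c - a),
    (IsSelfAdjoint.all _).smul hb0.isSelfAdjoint, ?_, ?_⟩
  · rw [norm_smul, norm_inv, Real.norm_of_nonneg hc.le, inv_mul_lt_iff₀ hc]
    simp only [c] at *
    linarith
  · rw [smul_sub (c⁻¹ : ℝ), Algebra.algebraMap_eq_smul_one, smul_smul, inv_mul_cancel₀ hc.ne',
      one_smul, sub_sub_cancel, Complex.coe_smul, smul_smul, mul_inv_cancel₀ hc.ne', one_smul]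

/-- The solution `X` of the Sylvester equation `aX + Xa = Y` is as good as `Y`. -/
lemma HasSchattenBound.exists_of_mul_add_mul {p C : ℝ} (hp : 1 ≤ p) {a X : H →L[ℂ] H}
    (ha : IsStrictlyPositive a) (hY : HasSchattenBound p C (a * X + X * a)) :
    ∃ D, HasSchattenBound p D X := by
  have hp0 : 0 < p := by linarith
  obtain ⟨c, hc, b, hb, hb1, hab⟩ := ha.exists_eq_smul_one_sub
  have hcC : (c : ℂ) ≠ 0 := by exact_mod_cast hc.ne'
  set Y := a * X + X * a
  -- Substituting `a = c(1 - b)` and solving for the term `2cX` turns the equation into `X = Φ X`.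
  set Φ : (H →L[ℂ] H) → (H →L[ℂ] H) :=
    fun Z => ((2 * c)⁻¹ : ℂ) • Y + (2⁻¹ : ℂ) • (b * Z + Z * b)
  have hfix : Φ X = X := by
    have hYeq : Y = (c : ℂ) • ((2 : ℂ) • X - (b * X + X * b)) := by
      simp only [Y, hab, smul_mul_assoc, mul_smul_comm, sub_mul, mul_sub, one_mul, mul_one,
        ← smul_add, two_smul]
      congr 1
      abel
    simp only [Φ]
    rw [hYeq, smul_smul, mul_inv, inv_mul_cancel_right₀ hcC, ← smul_add, sub_add_cancel,
      smul_smul, inv_mul_cancel₀ two_ne_zero, one_smul]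
  have hdiff : ∀ Z, ‖Φ Z - X‖ ≤ ‖b‖ * ‖Z - X‖ := by
    intro Z
    conv_lhs => rw [← hfix]
    have : Φ Z - Φ X = (2⁻¹ : ℂ) • (b * (Z - X) + (Z - X) * b) := by
      simp only [Φ, add_sub_add_left_eq_sub, ← smul_sub, mul_sub, sub_mul]
      congr 1
      abel
    rw [this, norm_smul, norm_inv, Complex.norm_ofNat]
    have h1 := norm_add_le (b * (Z - X)) ((Z - X) * b)
    have h2 := norm_mul_le b (Z - X)
    have h3 := norm_mul_le (Z - X) b
    linarith
  -- The fixed point of `D ↦ C/(2c) + ‖b‖D`, so that `Φ` preserves the bound `D` along the iteration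
  -- from `0`.
  set D := C / (2 * c) / (1 - ‖b‖)
  have hb1' : 0 < 1 - ‖b‖ := by linarith
  have hC := hY.nonneg
  have hD : D = C / (2 * c) + ‖b‖ * D := by
    simp only [D]
    field_simp
    ring
  have hbd : ∀ n : ℕ, HasSchattenBound p D (Φ^[n] 0) := by
    intro n
    induction n with
    | zero => exact (HasSchattenBound.zero hp0).mono (by positivity)
    | succ n ih =>
      rw [Function.iterate_succ_apply']
      refine ((hY.smul hp0 _).add hp (((ih.isSelfAdjoint_mul hp hb).add hp
        (ih.mul_isSelfAdjoint hp hb)).smul hp0 _)).mono (le_of_eq ?_)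
      conv_rhs => rw [hD]
      rw [norm_inv, norm_mul, norm_inv, Complex.norm_ofNat, Complex.norm_real,
        Real.norm_of_nonneg hc.le]
      field_simp
      ring
  have hnorm : ∀ n : ℕ, ‖Φ^[n] 0 - X‖ ≤ ‖b‖ ^ n * ‖X‖ := by
    intro n
    induction n with
    | zero => simp
    | succ n ih =>
      rw [Function.iterate_succ_apply', pow_succ', mul_assoc]
      exact (hdiff _).trans (mul_le_mul_of_nonneg_left ih (norm_nonneg _))
  refine ⟨D, HasSchattenBound.of_tendsto hp0 hbd ?_⟩
  rw [tendsto_iff_norm_sub_tendsto_zero]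
  refine squeeze_zero (fun _ => norm_nonneg _) hnorm ?_
  simpa using (tendsto_pow_atTop_nhds_zero_of_lt_one (norm_nonneg b) hb1).mul_const ‖X‖

end Sylvester

/-! ### `A^p` is a *-algebra closed under inverses and absolute values -/

section RestrictedAlgebra

variable {H : Type*} [NormedAddCommGroup H] [InnerProductSpace ℂ H] [CompleteSpace H]
  {K : Submodule ℂ H} [K.HasOrthogonalProjection] {p : ℝ}

lemma mem_restrictedAlgebra_iff (hp : 1 ≤ p) {A : H →L[ℂ] H} : A ∈ restrictedAlgebra K p ↔
    ∃ C, HasSchattenBound p C (A * K.starProjection - K.starProjection * A) := by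
  rw [restrictedAlgebra, Set.mem_ofPred_eq]
  exact ⟨fun h => ⟨_, hasSchattenBound_of_mem_schattenClass hp h⟩,
    fun ⟨_, h⟩ => h.mem_schattenClass hp⟩

namespace restrictedAlgebra

lemma smul_one_mem (hp : 1 ≤ p) (c : ℂ) : c • (1 : H →L[ℂ] H) ∈ restrictedAlgebra K p := by
  rw [mem_restrictedAlgebra_iff hp]
  exact ⟨0, by simpa using HasSchattenBound.zero (by linarith)⟩

lemma add_mem (hp : 1 ≤ p) {A B : H →L[ℂ] H} (hA : A ∈ restrictedAlgebra K p)
    (hB : B ∈ restrictedAlgebra K p) : A + B ∈ restrictedAlgebra K p := by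
  rw [mem_restrictedAlgebra_iff hp] at *
  obtain ⟨C, hC⟩ := hA
  obtain ⟨D, hD⟩ := hB
  refine ⟨C + D, ?_⟩
  rw [add_mul, mul_add, add_sub_add_comm]
  exact hC.add hp hD

lemma mul_mem (hp : 1 ≤ p) {A B : H →L[ℂ] H} (hA : A ∈ restrictedAlgebra K p)
    (hB : B ∈ restrictedAlgebra K p) : A * B ∈ restrictedAlgebra K p := by
  rw [mem_restrictedAlgebra_iff hp] at *
  obtain ⟨C, hC⟩ := hA
  obtain ⟨D, hD⟩ := hB
  obtain ⟨C', hC'⟩ := hC.exists_mul hp B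
  obtain ⟨D', hD'⟩ := hD.exists_mul_left hp A
  refine ⟨C' + D', ?_⟩
  convert hC'.add hp hD' using 1
  simp only [sub_mul, mul_sub, mul_assoc]
  abel

lemma star_mem (hp : 1 ≤ p) {A : H →L[ℂ] H} (hA : A ∈ restrictedAlgebra K p) :
    star A ∈ restrictedAlgebra K p := by
  rw [mem_restrictedAlgebra_iff hp] at *
  obtain ⟨C, hC⟩ := hA
  refine ⟨C, ?_⟩
  have h := (HasSchattenBound.star_iff.2 hC).neg
  rwa [star_sub, star_mul, star_mul, (isSelfAdjoint_starProjection K).star_eq, neg_sub] at h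

/-- `[B, E] = -B[A, E]B`. -/
lemma mem_of_mul_eq_one (hp : 1 ≤ p) {A B : H →L[ℂ] H} (hA : A ∈ restrictedAlgebra K p)
    (hAB : A * B = 1) (hBA : B * A = 1) : B ∈ restrictedAlgebra K p := by
  rw [mem_restrictedAlgebra_iff hp] at *
  obtain ⟨C, hC⟩ := hA
  obtain ⟨C', hC'⟩ := hC.exists_mul hp B
  obtain ⟨D, hD⟩ := hC'.exists_mul_left hp B
  refine ⟨D, ?_⟩
  convert hD.neg using 1
  simp only [sub_mul, mul_sub, mul_assoc, hAB, mul_one]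
  rw [← mul_assoc B A, hBA, one_mul, neg_sub]

/-- With `a = |A|`, the commutator `X = [a, E]` solves `aX + Xa = [a², E]`, where `a² = A*A`. -/
lemma operatorAbs_mem (hp : 1 ≤ p) {A : H →L[ℂ] H} (hA : A ∈ restrictedAlgebra K p)
    (hpos : IsStrictlyPositive (operatorAbs A)) : operatorAbs A ∈ restrictedAlgebra K p := by
  have h : operatorAbs A * operatorAbs A ∈ restrictedAlgebra K p := by
    rw [operatorAbs_mul_self]
    exact mul_mem hp (star_mem hp hA) hA
  rw [mem_restrictedAlgebra_iff hp] at h ⊢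
  obtain ⟨C, hC⟩ := h
  refine HasSchattenBound.exists_of_mul_add_mul hp hpos (C := C) ?_
  convert hC using 1
  simp only [sub_mul, mul_sub, mul_assoc]
  abel

end restrictedAlgebra

lemma subtype_mem_restrictedInvertibles (hp : 1 ≤ p) {A B : H →L[ℂ] H}
    (hA : A ∈ restrictedAlgebra K p) (hAB : A * B = 1) (hBA : B * A = 1) :
    (⟨A, hA⟩ : restrictedAlgebra K p) ∈ restrictedInvertibles K p :=
  ⟨⟨B, restrictedAlgebra.mem_of_mul_eq_one hp hA hAB hBA⟩, hAB, hBA⟩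

end RestrictedAlgebra

/-! ### Fredholm operators and the index -/

section Index

namespace LinearMap

variable {k V W : Type*} [Field k] [AddCommGroup V] [Module k V] [AddCommGroup W] [Module k W]

lemma index_eq_zero_of_bijective {f : V →ₗ[k] W} (hf : Function.Bijective f) : f.index = 0 :=
  (LinearEquiv.ofBijective f hf).index_eq_zero

/-- `1 + F` is `fst ∘ Φ ∘ inl` for the automorphism `Φ(v, w) = (v + Fv + w, Fv + w)` of `V ×
F.range`. Its index is that of `fst ∘ inl = id`. -/
lemma index_id_add_of_hasFiniteRange {F : V →ₗ[k] V} (hF : F.HasFiniteRange) :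
    (LinearMap.id + F).index = 0 := by
  have hR : FiniteDimensional k F.range := Module.Finite.of_fg hF
  let Φ : (V × F.range) ≃ₗ[k] (V × F.range) := LinearEquiv.ofLinearMap
    ((LinearMap.fst k V F.range + F.range.subtype ∘ₗ
      (F.rangeRestrict ∘ₗ LinearMap.fst k V F.range + LinearMap.snd k V F.range)).prod
      (F.rangeRestrict ∘ₗ LinearMap.fst k V F.range + LinearMap.snd k V F.range))
    ((LinearMap.fst k V F.range - F.range.subtype ∘ₗ LinearMap.snd k V F.range).prod
      (LinearMap.snd k V F.range - F.rangeRestrict ∘ₗ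
        (LinearMap.fst k V F.range - F.range.subtype ∘ₗ LinearMap.snd k V F.range)))
    (by ext <;> simp) (by ext <;> simp)
  have h1 : FiniteDimensional k (LinearMap.inl k V F.range).ker := by
    rw [LinearMap.ker_eq_bot.2 LinearMap.inl_injective]; infer_instance
  have h2 : FiniteDimensional k (LinearMap.fst k V F.range).ker := by
    rw [LinearMap.ker_fst]; infer_instance
  have h3 : FiniteDimensional k ((V × F.range) ⧸ (LinearMap.inl k V F.range).range) := by
    rw [LinearMap.range_inl]
    exact Module.Finite.equiv
      ((LinearMap.snd k V F.range).quotKerEquivOfSurjective LinearMap.snd_surjective).symm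
  have h4 : FiniteDimensional k (V ⧸ (LinearMap.fst k V F.range).range) := by
    rw [LinearMap.range_eq_top.2 LinearMap.fst_surjective]; infer_instance
  have h5 : FiniteDimensional k Φ.toLinearMap.ker := by
    rw [LinearEquiv.ker]; infer_instance
  have h6 : FiniteDimensional k ((V × F.range) ⧸ Φ.toLinearMap.range) := by
    rw [LinearEquiv.range]; infer_instance
  have h7 : FiniteDimensional k (Φ.toLinearMap ∘ₗ LinearMap.inl k V F.range).ker := by
    rw [LinearMap.ker_comp]; infer_instance
  have h8 : FiniteDimensional k
      ((V × F.range) ⧸ (Φ.toLinearMap ∘ₗ LinearMap.inl k V F.range).range) := by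
    rw [LinearMap.range_comp]; infer_instance
  have e1 : LinearMap.id + F
      = LinearMap.fst k V F.range ∘ₗ (Φ.toLinearMap ∘ₗ LinearMap.inl k V F.range) := by
    ext v
    simp [Φ]
  have e2 : LinearMap.fst k V F.range ∘ₗ LinearMap.inl k V F.range = LinearMap.id :=
    LinearMap.fst_comp_inl k V F.range
  have i1 := LinearMap.index_comp (f := LinearMap.inl k V F.range) (LinearMap.fst k V F.range)
  rw [e2, LinearMap.index_id] at i1
  rw [e1, LinearMap.index_comp, LinearMap.index_comp, LinearEquiv.index_eq_zero, zero_add, ← i1]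

end LinearMap

namespace ContinuousLinearMap

variable {E : Type*} [NormedAddCommGroup E] [InnerProductSpace ℂ E]

lemma IsFredholm.index_comp {u v : E →L[ℂ] E} (hu : u.IsFredholm) (hv : v.IsFredholm) :
    (v ∘L u).index = v.index + u.index := by
  have := hu.finite_ker
  have := hv.finite_ker
  have : FiniteDimensional ℂ (E ⧸ u.range) := hu.finite_coker
  have : FiniteDimensional ℂ (E ⧸ v.range) := hv.finite_coker
  exact LinearMap.index_comp v.toLinearMap (f := u.toLinearMap)

lemma isFredholm_of_isUnit {u : E →L[ℂ] E} (hu : IsUnit u) : u.IsFredholm ∧ u.index = 0 := by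
  obtain ⟨v, huv, hvu⟩ := isUnit_iff_exists.1 hu
  have h1 : v.toLinearMap ∘ₗ u.toLinearMap = LinearMap.id := congrArg toLinearMap hvu
  have h2 : u.toLinearMap ∘ₗ v.toLinearMap = LinearMap.id := congrArg toLinearMap huv
  refine ⟨IsFredholm.of_isQuasiInverse (v := v) ⟨?_, ?_⟩,
    LinearMap.index_eq_zero_of_bijective ⟨?_, ?_⟩⟩
  · rw [LinearMap.IsLeftQuasiInverse, h1]
  · rw [LinearMap.IsRightQuasiInverse, h2]
  · exact Function.LeftInverse.injective fun x => LinearMap.congr_fun h1 x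
  · exact Function.RightInverse.surjective fun x => LinearMap.congr_fun h2 x

lemma isFredholm_of_hasFiniteRange {u v : E →L[ℂ] E}
    (h : (v * u - 1).toLinearMap.HasFiniteRange) (h' : (u * v - 1).toLinearMap.HasFiniteRange) :
    u.IsFredholm :=
  IsFredholm.of_isQuasiInverse (v := v) ⟨LinearMap.FiniteRangeSetoid.equiv_iff_hasFiniteRange.2 h,
    LinearMap.FiniteRangeSetoid.equiv_iff_hasFiniteRange.2 h'⟩

/-- With `F` of finite rank and `‖A - F‖ < 1`, the operator `S = 1 + (A - F)` is invertible and `1 +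
A = S(1 + S⁻¹F)`. -/
lemma isFredholm_one_add_of_isApproximable [CompleteSpace E] {A : E →L[ℂ] E}
    (hA : IsApproximable A) : (1 + A).IsFredholm ∧ (1 + A).index = 0 := by
  obtain ⟨F, hF, hAF⟩ := hA (1 / 2) (by norm_num)
  have hS : IsUnit (1 + (A - F)) := by
    have h := isUnit_one_sub_of_norm_lt_one (x := -(A - F)) (by rw [norm_neg]; linarith)
    rwa [sub_neg_eq_add] at h
  obtain ⟨R, hSR, hRS⟩ := isUnit_iff_exists.1 hS
  have hRF : (R ∘L F).toLinearMap.HasFiniteRange := hF.comp_left R.toLinearMap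
  have hB : (1 + R * F).index = 0 := LinearMap.index_id_add_of_hasFiniteRange hRF
  have hBF : (1 + R * F).IsFredholm := by
    refine isFredholm_of_hasFiniteRange (v := 1) ?_ ?_
    · rwa [one_mul, add_sub_cancel_left]
    · rwa [mul_one, add_sub_cancel_left]
  have heq : 1 + A = (1 + (A - F)) ∘L (1 + R * F) := by
    change 1 + A = (1 + (A - F)) * (1 + R * F)
    rw [mul_add, mul_one, ← mul_assoc, hSR, one_mul]
    abel
  obtain ⟨hSF, hS0⟩ := isFredholm_of_isUnit hS
  refine ⟨?_, by rw [heq, hBF.index_comp hSF, hS0, hB, add_zero]⟩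
  have hA : 1 + A = (1 + (A - F)) + F := by abel
  refine isFredholm_of_hasFiniteRange (v := R) ?_ ?_
  · rwa [hA, mul_add, hRS, add_sub_cancel_left]
  · rw [hA, add_mul, hSR, add_sub_cancel_left]
    exact hF.comp_right R.toLinearMap

open LinearMap.FiniteRangeSetoid in
/-- Atkinson's criterion: operators invertible modulo approximable operators are Fredholm. -/
lemma isFredholm_of_isApproximable [CompleteSpace E] {T B A A' : E →L[ℂ] E}
    (hA : IsApproximable A) (hA' : IsApproximable A') (hTB : T * B = 1 + A)
    (hBT : B * T = 1 + A') : T.IsFredholm := by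
  obtain ⟨Q, -, hQ⟩ := (isFredholm_one_add_of_isApproximable hA).1.exists_isQuasiInverse
  obtain ⟨Q', hQ', -⟩ := (isFredholm_one_add_of_isApproximable hA').1.exists_isQuasiInverse
  have h1 : T.toLinearMap ∘ₗ (B.toLinearMap ∘ₗ Q.toLinearMap) ≈ LinearMap.id := by
    have h := hQ.equiv
    rw [← hTB] at h
    exact h
  have h2 : (Q'.toLinearMap ∘ₗ B.toLinearMap) ∘ₗ T.toLinearMap ≈ LinearMap.id := by
    have h := hQ'.equiv
    rw [← hBT] at h
    exact h
  -- A left and a right inverse modulo finite rank agree modulo finite rank.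
  have h3 : Q'.toLinearMap ∘ₗ B.toLinearMap ≈ B.toLinearMap ∘ₗ Q.toLinearMap := by
    have h4 := equiv_comp_left (u' := Q'.toLinearMap ∘ₗ B.toLinearMap) h1
    have h5 := equiv_comp_right (u := B.toLinearMap ∘ₗ Q.toLinearMap) h2
    exact Setoid.trans (Setoid.symm h4) h5
  refine IsFredholm.of_isQuasiInverse (v := B ∘L Q) ⟨?_, h1⟩
  exact Setoid.trans (equiv_comp_right (u := T.toLinearMap) (Setoid.symm h3)) h2

lemma index_add_index_of_isApproximable [CompleteSpace E] {T B A A' : E →L[ℂ] E}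
    (hA : IsApproximable A) (hA' : IsApproximable A') (hTB : T * B = 1 + A)
    (hBT : B * T = 1 + A') : T.index + B.index = 0 := by
  have hT := isFredholm_of_isApproximable hA hA' hTB hBT
  have hB := isFredholm_of_isApproximable hA' hA hBT hTB
  rw [← hB.index_comp hT, ← (isFredholm_one_add_of_isApproximable hA).2, ← hTB]
  rfl

end ContinuousLinearMap

end Index

/-! ### Matrix entries: Fredholmness and index -/

section Entries

variable {H : Type*} [NormedAddCommGroup H] [InnerProductSpace ℂ H]

lemma inner_matrixEntry (K L : Submodule ℂ H) [L.HasOrthogonalProjection] (A : H →L[ℂ] H) (x : K)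
    (y : L) : inner ℂ y (matrixEntry K L A x) = inner ℂ (y : H) (A x) :=
  Submodule.inner_orthogonalProjectionOnto_eq_of_mem_left _ _

lemma matrixEntry_add (K L : Submodule ℂ H) [L.HasOrthogonalProjection] (A B : H →L[ℂ] H) :
    matrixEntry K L (A + B) = matrixEntry K L A + matrixEntry K L B := by
  ext x
  simp [matrixEntry]

lemma matrixEntry_smul (K L : Submodule ℂ H) [L.HasOrthogonalProjection] (c : ℂ)
    (A : H →L[ℂ] H) : matrixEntry K L (c • A) = c • matrixEntry K L A := by
  ext x
  simp [matrixEntry]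

lemma matrixEntry_one (K : Submodule ℂ H) [K.HasOrthogonalProjection] :
    matrixEntry K K (1 : H →L[ℂ] H) = 1 := by
  ext x
  simp [matrixEntry]

lemma matrixEntry_mul (K L M : Submodule ℂ H) [K.HasOrthogonalProjection]
    [M.HasOrthogonalProjection] (A B : H →L[ℂ] H) :
    matrixEntry L M (A * B) = matrixEntry K M A ∘L matrixEntry L K B
      + matrixEntry Kᗮ M A ∘L matrixEntry L Kᗮ B := by
  ext x
  have h := K.starProjection_add_starProjection_orthogonal (B x)
  simp only [matrixEntry, ContinuousLinearMap.comp_apply, mul_apply_eq_comp, add_apply,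
    Submodule.subtypeL_apply]
  conv_lhs => rw [← h, map_add, map_add]
  rfl

variable [CompleteSpace H] {K : Submodule ℂ H} [K.HasOrthogonalProjection] {p : ℝ}

/-- The corners of `[A, E]` are `-A₁₂` and `A₂₁`; compression to them preserves the bound. -/
lemma hasSchattenBound_matrixEntry_orthogonal_left (hp : 1 ≤ p) {A : H →L[ℂ] H}
    (hA : A ∈ restrictedAlgebra K p) : ∃ C, HasSchattenBound p C (matrixEntry Kᗮ K A) := by
  obtain ⟨C, hC⟩ := (mem_restrictedAlgebra_iff hp).1 hA
  refine ⟨C, hC.neg.compress Kᗮ.subtypeₗᵢ K.subtypeₗᵢ fun x y => ?_⟩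
  have h1 : K.starProjection (x : H) = 0 :=
    (K.starProjection_apply_eq_zero_iff).2 x.2
  rw [inner_matrixEntry, Submodule.coe_subtypeₗᵢ, Submodule.coe_subtypeₗᵢ, Submodule.subtype_apply,
    Submodule.subtype_apply, neg_apply, sub_apply, mul_apply_eq_comp, mul_apply_eq_comp, h1,
    map_zero, zero_sub, neg_neg, ← K.inner_starProjection_left_eq_right,
    Submodule.starProjection_eq_self_iff.2 y.2]

lemma hasSchattenBound_matrixEntry_orthogonal_right (hp : 1 ≤ p) {A : H →L[ℂ] H}
    (hA : A ∈ restrictedAlgebra K p) : ∃ C, HasSchattenBound p C (matrixEntry K Kᗮ A) := by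
  obtain ⟨C, hC⟩ := (mem_restrictedAlgebra_iff hp).1 hA
  refine ⟨C, hC.compress K.subtypeₗᵢ Kᗮ.subtypeₗᵢ fun x y => ?_⟩
  have h1 : K.starProjection (y : H) = 0 :=
    (K.starProjection_apply_eq_zero_iff).2 y.2
  rw [inner_matrixEntry, Submodule.coe_subtypeₗᵢ, Submodule.coe_subtypeₗᵢ, Submodule.subtype_apply,
    Submodule.subtype_apply, sub_apply, mul_apply_eq_comp, mul_apply_eq_comp,
    Submodule.starProjection_eq_self_iff.2 x.2, inner_sub_right,
    ← K.inner_starProjection_left_eq_right, h1, inner_zero_left, sub_zero]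

lemma isApproximable_matrixEntry_comp (hp : 1 ≤ p) {A : H →L[ℂ] H}
    (hA : A ∈ restrictedAlgebra K p) (B : H →L[ℂ] H) :
    IsApproximable (matrixEntry Kᗮ K A ∘L matrixEntry K Kᗮ B) := by
  obtain ⟨C, hC⟩ := hasSchattenBound_matrixEntry_orthogonal_left hp hA
  exact (hC.isApproximable (by linarith)).comp_right _

lemma matrixEntry_mul_self_of_mul_eq_one {A B : H →L[ℂ] H} (hAB : A * B = 1) :
    matrixEntry K K A * matrixEntry K K B
      = 1 + -(matrixEntry Kᗮ K A ∘L matrixEntry K Kᗮ B) := by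
  have h := matrixEntry_mul K K K A B
  rw [hAB, matrixEntry_one] at h
  rw [h, add_neg_cancel_right]
  rfl

/-- A lower bound `r ≤ M` passes to the compression. -/
lemma isUnit_matrixEntry_self [CompleteSpace K] {M : H →L[ℂ] H} (hM : IsStrictlyPositive M) :
    IsUnit (matrixEntry K K M) := by
  obtain ⟨r, hr, hrM⟩ := hM.exists_pos_algebraMap_le
  have h1 : (M - algebraMap ℝ (H →L[ℂ] H) r).IsPositive := hrM
  have h2 : 0 ≤ matrixEntry K K (M - algebraMap ℝ (H →L[ℂ] H) r) :=
    (ContinuousLinearMap.nonneg_iff_isPositive _).2 (h1.orthogonalProjectionOnto_comp K)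
  have h3 : matrixEntry K K M
      = r • (1 : K →L[ℂ] K) + matrixEntry K K (M - algebraMap ℝ (H →L[ℂ] H) r) := by
    have h4 : M = (r : ℂ) • (1 : H →L[ℂ] H) + (M - algebraMap ℝ (H →L[ℂ] H) r) := by
      rw [Algebra.algebraMap_eq_smul_one, Complex.coe_smul, add_sub_cancel]
    conv_lhs => rw [h4]
    rw [matrixEntry_add, matrixEntry_smul, matrixEntry_one]
    rfl
  rw [h3]
  exact (isStrictlyPositive_smul_one_add hr h2).isUnit

variable [CompleteSpace K]

lemma isFredholm_matrixEntry_self (hp : 1 ≤ p) {A B : H →L[ℂ] H} (hA : A ∈ restrictedAlgebra K p)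
    (hB : B ∈ restrictedAlgebra K p) (hAB : A * B = 1) (hBA : B * A = 1) :
    (matrixEntry K K A).IsFredholm :=
  ContinuousLinearMap.isFredholm_of_isApproximable
    (isApproximable_matrixEntry_comp hp hA B).neg (isApproximable_matrixEntry_comp hp hB A).neg
    (matrixEntry_mul_self_of_mul_eq_one hAB) (matrixEntry_mul_self_of_mul_eq_one hBA)

/-- Multiplication by a positive invertible operator does not change the index. -/
lemma index_matrixEntry_mul_of_isStrictlyPositive (hp : 1 ≤ p) {U M B : H →L[ℂ] H}
    (hU : U ∈ restrictedAlgebra K p) (hM : IsStrictlyPositive M)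
    (hUF : (matrixEntry K K U).IsFredholm) (hUM : U * M ∈ restrictedAlgebra K p)
    (hB : B ∈ restrictedAlgebra K p) (h1 : U * M * B = 1) (h2 : B * (U * M) = 1) :
    (matrixEntry K K (U * M)).index = (matrixEntry K K U).index := by
  have i1 := ContinuousLinearMap.index_add_index_of_isApproximable
    (isApproximable_matrixEntry_comp hp hUM B).neg
    (isApproximable_matrixEntry_comp hp hB (U * M)).neg
    (matrixEntry_mul_self_of_mul_eq_one h1) (matrixEntry_mul_self_of_mul_eq_one h2)
  have hR := isApproximable_matrixEntry_comp hp hU M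
  set R := matrixEntry Kᗮ K U ∘L matrixEntry K Kᗮ M
  have heq : matrixEntry K K U ∘L matrixEntry K K M = matrixEntry K K (U * M) - R :=
    eq_sub_of_add_eq (matrixEntry_mul K K K U M).symm
  -- `B₁₁` inverts both `(UM)₁₁` and `U₁₁M₁₁ = (UM)₁₁ - R` up to approximable operators, so both
  -- have index `-ind B₁₁`.
  have i2 : (matrixEntry K K U ∘L matrixEntry K K M).index + (matrixEntry K K B).index = 0 := by
    refine ContinuousLinearMap.index_add_index_of_isApproximable
      (A := -(matrixEntry Kᗮ K (U * M) ∘L matrixEntry K Kᗮ B) + -(R ∘L matrixEntry K K B))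
      (A' := -(matrixEntry Kᗮ K B ∘L matrixEntry K Kᗮ (U * M)) + -(matrixEntry K K B ∘L R))
      ((isApproximable_matrixEntry_comp hp hUM B).neg.add (hR.comp_right _).neg)
      ((isApproximable_matrixEntry_comp hp hB (U * M)).neg.add (hR.comp_left _).neg) ?_ ?_
    · rw [heq, sub_mul, matrixEntry_mul_self_of_mul_eq_one h1, sub_eq_add_neg, add_assoc]
      rfl
    · rw [heq, mul_sub, matrixEntry_mul_self_of_mul_eq_one h2, sub_eq_add_neg, add_assoc]
      rfl
  obtain ⟨hMF, hM0⟩ := ContinuousLinearMap.isFredholm_of_isUnit (isUnit_matrixEntry_self (K := K) hM)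
  rw [hMF.index_comp hUF, hM0, add_zero] at i2
  linarith

end Entries

/-! ### Homogeneity of the Schatten norm -/

section Homogeneity

variable {H₁ H₂ : Type*}
  [NormedAddCommGroup H₁] [InnerProductSpace ℂ H₁] [CompleteSpace H₁]
  [NormedAddCommGroup H₂] [InnerProductSpace ℂ H₂] [CompleteSpace H₂]

lemma enorm_clm_smul (c : ℂ) (T : H₁ →L[ℂ] H₂) : ‖c • T‖ₑ = ‖c‖ₑ * ‖T‖ₑ := by
  rw [← ofReal_norm, norm_smul, ENNReal.ofReal_mul (norm_nonneg _), ofReal_norm, ofReal_norm]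

lemma smul_nonneg_of_nonneg {r : ℝ} (hr : 0 ≤ r) {a : H₁ →L[ℂ] H₁} (ha : 0 ≤ a) : 0 ≤ r • a := by
  rw [ContinuousLinearMap.nonneg_iff_isPositive] at *
  rw [← Complex.coe_smul]
  exact ha.smul_of_nonneg (by exact_mod_cast hr)

lemma operatorAbs_smul (c : ℂ) (T : H₁ →L[ℂ] H₂) : operatorAbs (c • T) = ‖c‖ • operatorAbs T := by
  refine CFC.sqrt_unique ?_ (smul_nonneg_of_nonneg (norm_nonneg c) (operatorAbs_nonneg T))
  rw [smul_mul_smul_comm, operatorAbs_mul_self, map_smulₛₗ, ContinuousLinearMap.smul_comp,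
    ContinuousLinearMap.comp_smul, smul_smul, ← Complex.coe_smul, Complex.conj_mul']
  push_cast
  rw [sq]

lemma smul_rpow_of_nonneg {r p : ℝ} (hr : 0 ≤ r) (hp : 0 < p) {a : H₁ →L[ℂ] H₁} (ha : 0 ≤ a) :
    (r • a) ^ p = r ^ p • a ^ p := by
  have hc : Continuous fun x : ℝ => x ^ p := Real.continuous_rpow_const hp.le
  rw [CFC.rpow_eq_cfc_real (smul_nonneg_of_nonneg hr ha), CFC.rpow_eq_cfc_real ha,
    ← cfc_comp_smul r _ a hc.continuousOn ha.isSelfAdjoint,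
    ← cfc_smul (r ^ p) _ a hc.continuousOn]
  refine cfc_congr fun x hx => ?_
  exact Real.mul_rpow hr (spectrum_nonneg_of_nonneg ha hx)

lemma positiveTrace_smul {r : ℝ} (hr : 0 ≤ r) (A : H₁ →L[ℂ] H₁) :
    positiveTrace (r • A) = ENNReal.ofReal r * positiveTrace A := by
  unfold positiveTrace diagonalSum
  rw [← ENNReal.tsum_mul_left]
  refine tsum_congr fun i => ?_
  rw [smul_apply, inner_smul_right_eq_smul, RCLike.smul_re, ENNReal.ofReal_mul hr]

lemma schattenNorm_smul {p : ℝ} (hp : 0 < p) (c : ℂ) (T : H₁ →L[ℂ] H₂) :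
    schattenNorm p (c • T) = ‖c‖ₑ * schattenNorm p T := by
  rw [schattenNorm, operatorAbs_smul, smul_rpow_of_nonneg (norm_nonneg c) hp (operatorAbs_nonneg T),
    positiveTrace_smul (by positivity), ENNReal.mul_rpow_of_nonneg _ _ (by positivity),
    ENNReal.ofReal_rpow_of_nonneg (by positivity) (by positivity), ← Real.rpow_mul (norm_nonneg c),
    mul_one_div_cancel hp.ne', Real.rpow_one, ofReal_norm, schattenNorm]

lemma HasSchattenBound.schattenNorm_lt_top {p C : ℝ} (hp : 1 ≤ p) {T : H₁ →L[ℂ] H₂}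
    (hT : HasSchattenBound p C T) : schattenNorm p T < ∞ := by
  have h : positiveTrace (operatorAbs T ^ p) < ∞ := hT.mem_schattenClass hp
  exact ENNReal.rpow_lt_top_of_nonneg (by positivity) h.ne

end Homogeneity

/-! ### Segments in the topology of `‖·‖_{∞,p}` -/

section Topology

variable {H : Type*} [NormedAddCommGroup H] [InnerProductSpace ℂ H] [CompleteSpace H]
  {K : Submodule ℂ H} [CompleteSpace K] {p : ℝ}

lemma restrictedNorm_smul (hp : 0 < p) (c : ℂ) (A : H →L[ℂ] H) :
    restrictedNorm K p (c • A) = ‖c‖ₑ * restrictedNorm K p A := by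
  simp only [restrictedNorm, matrixEntry_smul, schattenNorm_smul hp, enorm_clm_smul, mul_add]

lemma restrictedNorm_lt_top (hp : 1 ≤ p) {A : H →L[ℂ] H} (hA : A ∈ restrictedAlgebra K p) :
    restrictedNorm K p A < ∞ := by
  obtain ⟨C, hC⟩ := hasSchattenBound_matrixEntry_orthogonal_left hp hA
  obtain ⟨D, hD⟩ := hasSchattenBound_matrixEntry_orthogonal_right hp hA
  simp only [restrictedNorm, ENNReal.add_lt_top]
  exact ⟨⟨⟨enorm_lt_top, enorm_lt_top⟩, hC.schattenNorm_lt_top hp⟩, hD.schattenNorm_lt_top hp⟩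

/-- Affine paths are Lipschitz by homogeneity and finiteness of the norm alone, without its triangle
inequality. -/
lemma continuous_restrictedTopology_of_sub_eq_smul (hp : 1 ≤ p) {γ : ℝ → restrictedAlgebra K p}
    {C : H →L[ℂ] H} (hC : C ∈ restrictedAlgebra K p)
    (h : ∀ s t : ℝ, (γ s).1 - (γ t).1 = ((s - t : ℝ) : ℂ) • C) :
    @Continuous _ _ _ (restrictedTopology K p) γ := by
  letI := restrictedTopology K p
  refine continuous_def.2 fun s hs => Metric.isOpen_iff.2 fun t ht => ?_
  obtain ⟨ε, hε, hεs⟩ := hs (γ t) ht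
  have hN := restrictedNorm_lt_top hp hC
  set N := (restrictedNorm K p C).toReal with hNdef
  have hN0 : 0 ≤ N := ENNReal.toReal_nonneg
  refine ⟨ε / (N + 1), by positivity, fun r hr => hεs (γ r) ?_⟩
  rw [Metric.mem_ball, Real.dist_eq, lt_div_iff₀ (by positivity)] at hr
  rw [h, restrictedNorm_smul (by linarith), ← ENNReal.ofReal_toReal hN.ne, ← hNdef, ← ofReal_norm,
    Complex.norm_real, Real.norm_eq_abs, ← ENNReal.ofReal_mul (abs_nonneg _)]
  refine (ENNReal.ofReal_lt_ofReal_iff hε).2 (lt_of_le_of_lt ?_ hr)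
  gcongr
  linarith

/-- A unitary `U` and its product with a positive invertible `M` are joined by the segment
`U ((1 - t) M + t)` in the group of invertibles. -/
lemma mem_restrictedComponent_mul (hp : 1 ≤ p) {U M : H →L[ℂ] H} (hU : U ∈ restrictedAlgebra K p)
    (hUu : U ∈ unitary (H →L[ℂ] H)) (hM : M ∈ restrictedAlgebra K p) (hpos : IsStrictlyPositive M)
    (hUM : U * M ∈ restrictedAlgebra K p) :
    (⟨U, hU⟩ : restrictedAlgebra K p) ∈ restrictedComponent K p ⟨U * M, hUM⟩ := by
  have hseg : ∀ t : ℝ, (t : ℂ) • (1 : H →L[ℂ] H) + ((1 - t : ℝ) : ℂ) • M ∈ restrictedAlgebra K p := by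
    intro t
    refine restrictedAlgebra.add_mem hp (restrictedAlgebra.smul_one_mem hp _) ?_
    rw [← one_mul M, ← smul_mul_assoc]
    exact restrictedAlgebra.mul_mem hp (restrictedAlgebra.smul_one_mem hp _) hM
  set γ : ℝ → restrictedAlgebra K p := fun t =>
    ⟨U * ((t : ℂ) • (1 : H →L[ℂ] H) + ((1 - t : ℝ) : ℂ) • M),
      restrictedAlgebra.mul_mem hp hU (hseg t)⟩
  have hC : U * (1 + (-1 : ℂ) • M) ∈ restrictedAlgebra K p := by
    refine restrictedAlgebra.mul_mem hp hU (restrictedAlgebra.add_mem hp ?_ ?_)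
    · simpa using restrictedAlgebra.smul_one_mem (K := K) (p := p) hp 1
    · rw [← one_mul M, ← smul_mul_assoc]
      exact restrictedAlgebra.mul_mem hp (restrictedAlgebra.smul_one_mem hp _) hM
  have hγ : @Continuous _ _ _ (restrictedTopology K p) γ := by
    refine continuous_restrictedTopology_of_sub_eq_smul hp hC fun s t => ?_
    simp only [γ]
    rw [← mul_sub, ← mul_smul_comm]
    congr 1
    push_cast
    module
  have h0 : γ 0 = ⟨U * M, hUM⟩ := Subtype.ext (by simp [γ])
  have h1 : γ 1 = ⟨U, hU⟩ := Subtype.ext (by simp [γ])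
  letI := restrictedTopology K p
  have hpre : IsPreconnected (γ '' Set.Icc 0 1) :=
    isPreconnected_Icc.image γ hγ.continuousOn
  have hsub : γ '' Set.Icc 0 1 ⊆ restrictedInvertibles K p := by
    rintro _ ⟨t, ht, rfl⟩
    have hpt : IsStrictlyPositive ((t : ℂ) • (1 : H →L[ℂ] H) + ((1 - t : ℝ) : ℂ) • M) := by
      rw [Complex.coe_smul, Complex.coe_smul]
      rcases ht.1.eq_or_lt with rfl | h
      · simpa using hpos
      · exact isStrictlyPositive_smul_one_add h (smul_nonneg_of_nonneg (by linarith [ht.2]) hpos.nonneg)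
    obtain ⟨N, hN, hN'⟩ := isUnit_iff_exists.1 hpt.isUnit
    obtain ⟨hU1, hU2⟩ := Unitary.mem_iff.1 hUu
    refine subtype_mem_restrictedInvertibles hp _ (B := N * star U) ?_ ?_
    · rw [mul_assoc, ← mul_assoc _ N, hN, one_mul, hU2]
    · rw [mul_assoc, ← mul_assoc (star U), hU1, one_mul, hN']
  have hmem := hpre.subset_connectedComponentIn (Set.mem_image_of_mem γ
    (Set.left_mem_Icc.2 zero_le_one)) hsub (Set.mem_image_of_mem γ
    (Set.right_mem_Icc.2 zero_le_one))
  rw [h0, h1] at hmem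
  exact hmem

end Topology

/-! ### Polar decomposition of an invertible operator -/

section PolarDecomposition

variable {H : Type*} [NormedAddCommGroup H] [InnerProductSpace ℂ H] [CompleteSpace H]

lemma isStrictlyPositive_operatorAbs {G : H →L[ℂ] H} (hG : IsUnit G) :
    IsStrictlyPositive (operatorAbs G) := by
  have h : IsUnit (ContinuousLinearMap.adjoint G ∘L G) := hG.star.mul hG
  exact ((CFC.isUnit_sqrt_iff _ (adjoint_comp_self_nonneg G)).2 h).isStrictlyPositive
    (operatorAbs_nonneg G)

/-- `(GN)*(GN) = N|G|²N = 1`, and an invertible isometry is unitary. -/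
lemma mul_inv_operatorAbs_mem_unitary {G N : H →L[ℂ] H} (hG : IsUnit G)
    (h : operatorAbs G * N = 1) (h' : N * operatorAbs G = 1) : G * N ∈ unitary (H →L[ℂ] H) := by
  have hN : star N = N := by
    have h1 : star N * operatorAbs G = 1 := by
      rw [← (operatorAbs_nonneg G).isSelfAdjoint.star_eq, ← star_mul, h, star_one]
    exact left_inv_eq_right_inv h1 h
  have h1 : star (G * N) * (G * N) = 1 := by
    have h2 : star G * G = operatorAbs G * operatorAbs G := (operatorAbs_mul_self G).symm
    rw [star_mul, hN, mul_assoc, ← mul_assoc (star G), h2, mul_assoc, h, mul_one, h']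
  have hu : IsUnit (G * N) := hG.mul (isUnit_iff_exists.2 ⟨_, h', h⟩)
  obtain ⟨B, hB, -⟩ := isUnit_iff_exists.1 hu
  exact Unitary.mem_iff.2 ⟨h1, by rw [left_inv_eq_right_inv h1 hB, hB]⟩

lemma IsPolarDecomposition.eq_mul_of_mul_eq_one {G U N : H →L[ℂ] H} (hU : IsPolarDecomposition G U)
    (h : operatorAbs G * N = 1) : U = G * N := by
  conv_rhs => rw [hU.eq_mul_abs]
  rw [mul_assoc, h, mul_one]

lemma isPolarDecomposition_mul {G N : H →L[ℂ] H} (hG : IsUnit G)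
    (h : operatorAbs G * N = 1) (h' : N * operatorAbs G = 1) : IsPolarDecomposition G (G * N) := by
  have hker : ∀ {A : H →L[ℂ] H}, IsUnit A → A.ker = ⊥ := by
    intro A hA
    obtain ⟨B, -, hB⟩ := isUnit_iff_exists.1 hA
    exact LinearMap.ker_eq_bot.2
      (Function.LeftInverse.injective fun x => DFunLike.congr_fun hB x)
  refine ⟨by rw [mul_assoc, h', mul_one], ?_, ?_⟩
  · rw [mul_assoc, (Unitary.mem_iff.1 (mul_inv_operatorAbs_mem_unitary hG h h')).1, mul_one]
  · rw [hker hG, hker (hG.mul (isUnit_iff_exists.2 ⟨_, h', h⟩))]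

end PolarDecomposition

theorem mainTheorem9 {H : Type*} [NormedAddCommGroup H] [InnerProductSpace ℂ H] [CompleteSpace H]
    (K : Submodule ℂ H) [CompleteSpace K]
    (hK : ¬ FiniteDimensional ℂ K) (hK' : ¬ FiniteDimensional ℂ Kᗮ)
    (p : ℝ) (hp : 1 ≤ p)
    (G : restrictedAlgebra K p) (hG : G ∈ restrictedInvertibles K p) :
    (∃! U : H →L[ℂ] H, IsPolarDecomposition G.1 U) ∧
    ∀ U : H →L[ℂ] H, IsPolarDecomposition G.1 U →
      ∃ M V : restrictedAlgebra K p, M.1 = operatorAbs G.1 ∧ V.1 = U ∧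
        M ∈ restrictedInvertibles K p ∧
        V ∈ restrictedUnitaries K p ∧
        (matrixEntry K K G.1).IsFredholm ∧
        (matrixEntry K K U).IsFredholm ∧
        (matrixEntry K K G.1).index = (matrixEntry K K U).index ∧
        V ∈ restrictedComponent K p G := by
  obtain ⟨G, hGA⟩ := G
  obtain ⟨⟨B, hBA⟩, hGB, hBG⟩ := hG
  dsimp only at hGB hBG ⊢
  have hGu : IsUnit G := isUnit_iff_exists.2 ⟨B, hGB, hBG⟩
  have hpos := isStrictlyPositive_operatorAbs hGu
  obtain ⟨N, hN, hN'⟩ := isUnit_iff_exists.1 hpos.isUnit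
  refine ⟨⟨G * N, isPolarDecomposition_mul hGu hN hN', fun U hU => hU.eq_mul_of_mul_eq_one hN⟩,
    fun U hU => ?_⟩
  have hMA := restrictedAlgebra.operatorAbs_mem hp hGA hpos
  have hNA := restrictedAlgebra.mem_of_mul_eq_one hp hMA hN hN'
  have hUeq := hU.eq_mul_of_mul_eq_one hN
  have hUA : U ∈ restrictedAlgebra K p := hUeq ▸ restrictedAlgebra.mul_mem hp hGA hNA
  have hUu : U ∈ unitary (H →L[ℂ] H) := hUeq ▸ mul_inv_operatorAbs_mem_unitary hGu hN hN'
  obtain ⟨hU1, hU2⟩ := Unitary.mem_iff.1 hUu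
  -- The inverse of `U` is `U*`, which is again in `A^p`.
  have hUF := isFredholm_matrixEntry_self hp hUA (restrictedAlgebra.star_mem hp hUA) hU2 hU1
  have hGeq : G = U * operatorAbs G := hU.eq_mul_abs
  refine ⟨⟨operatorAbs G, hMA⟩, ⟨U, hUA⟩, rfl, rfl,
    subtype_mem_restrictedInvertibles hp hMA hN hN',
    ⟨subtype_mem_restrictedInvertibles hp hUA hU2 hU1, hUu⟩,
    isFredholm_matrixEntry_self hp hGA hBA hGB hBG, hUF, ?_, ?_⟩
  · have h := index_matrixEntry_mul_of_isStrictlyPositive hp hUA hpos hUF (hGeq ▸ hGA) hBA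
      (by rw [← hGeq, hGB]) (by rw [← hGeq, hBG])
    rwa [← hGeq] at h
  · have h := mem_restrictedComponent_mul hp hUA hUu hMA hpos
      (restrictedAlgebra.mul_mem hp hUA hMA)
    simpa only [← hGeq] using h
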